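/- **Model.** Fix $n$ qudits of local dimension $q\ge 2$. An *ansatz* is a random parameterized circuit $U_V(\theta)$ on $(\mathbb C^q)^{\otimes n}$ built from $m$ entangling gates and $p$ parameterized gates. The entangling gates $V=(V_1,\dots,V_m)$ act in a fixed order, each on a fixed pair of distinct (not necessarily adjacent) qudits; they are independent, and each is drawn from a probability measure on $\mathrm U(q^2)$ that is a unitary 2-design, i.e. $\mathbb E[V_t\otimes V_t\otimes\bar V_t\otimes\bar V_t]$ equals its Haar value. Every qudit is acted on by at least one entangling gate. Each entangling gate may be immediately preceded and succeeded by any number of parameterized gates acting on one or both of its two qudits, and there are no other gates. A parameterized gate has the form $W_l e^{-iA\theta_j}W_r$ with $W_l,W_r$ fixed unitaries and $A=A_j$ Hermitian such that $e^{-iA\theta}$ is $2\pi$-periodic in $\theta$; each such gate has its own parameter $\theta_j$. The architecture, the number of gates and the 2-designs are otherwise arbitrary. Write $\mathbb E_V$ for the average over the entangling gates and $\mathbb E_\theta$ for the average over $\theta$ uniform in $[0,2\pi]^p$. Let $M_0=I,M_1,\dots,M_{q^2-1}\in\mathbb C^{q\times q}$ satisfy $\operatorname{tr}(M_i^\dagger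 M_j)=q\,\delta_{ij}$. For $x\in\{0,\dots,q^2-1\}^n$ put $M_x=M_{x_1}\otimes\cdots\otimes M_{x_n}$, let $|x|$ be the number of nonzero entries of $x$, and let $$g_x=\mathbb E_V\,\mathbb E_\theta\,\bigl|\langle 0^n|U_V(\theta)^\dagger M_x U_V(\theta)|0^n\rangle\bigr|^2 .$$ **Statement.** There is an absolute constant $c>0$ such that for all $q\ge2$, all $n$, every ansatz as above and every such family $(M_i)$: 1. For every $x$ with $|x|\ge n/2$, $$g_x\le q^{-cn}.$$ 2. (Global observables always have barren plateaus.) Let $H$ be a Hermitian operator on $(\mathbb C^q)^{\otimes n}$ with expansion $H=\sum_x c_xM_x$, $c_x=q^{-n}\operatorname{tr}(M_x^\dagger H)$, such that $|x|\ge n/2$ whenever $c_x\ne0$, and let $f_V(\theta)=\langle 0^n|U_V(\theta)^\dagger H U_V(\theta)|0^n\rangle$. Then $$\mathbb E_V\mathbb E_\theta\, f_V(\theta)^2\le q^{-cn}\sum_x|c_x|^2,$$ $$\mathbb E_V\mathbb E_\theta\,\|\nabla f_V(\theta)\|^2\le 4\Bigl(\sum_j\|A_j\|^2\Bigr)\|H\|\;q^{-cn/2}\Bigl(\sum_x|c_x|^2\Bigr)^{1/2},$$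 where $\|\cdot\|$ denotes the operator norm of matrices and the Euclidean norm of the gradient. -/

import Mathlib

open MeasureTheory
open scoped Matrix

noncomputable section

namespace BarrenPlateau

/-! ### Two-qudit unitaries and unitary 2-designs -/

/-- The unitary group `U(q²)`, acting on the space `ℂ^q ⊗ ℂ^q` of two qudits. -/
abbrev TwoQuditUnitary (q : ℕ) : Type :=
  ↥(Matrix.unitaryGroup (Fin q × Fin q) ℂ)

instance (q : ℕ) : MeasurableSpace (TwoQuditUnitary q) := borel _

instance (q : ℕ) : BorelSpace (TwoQuditUnitary q) := ⟨rfl⟩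

/-- The unitary group is compact, hence it carries a Haar probability measure. -/
instance (q : ℕ) : CompactSpace (TwoQuditUnitary q) := by
  refine isCompact_iff_compactSpace.mp ?_
  have hbox : IsCompact (Set.pi Set.univ fun _ : Fin q × Fin q =>
      Set.pi Set.univ fun _ : Fin q × Fin q => Metric.closedBall (0 : ℂ) 1) :=
    isCompact_univ_pi fun _ => isCompact_univ_pi fun _ => isCompact_closedBall _ _
  refine IsCompact.of_isClosed_subset hbox ?_ ?_
  · exact isClosed_unitary
  · intro U hU i _ j _
    simpa using entry_norm_bound_of_unitary hU i j

/-- The Haar probability measure on `U(q²)`. -/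
def haarProb (q : ℕ) : Measure (TwoQuditUnitary q) :=
  Measure.haarMeasure (⊤ : TopologicalSpace.PositiveCompacts (TwoQuditUnitary q))

/-- `μ` is a unitary 2-design: it is a probability measure and
`E_μ[U ⊗ U ⊗ Ū ⊗ Ū] = E_Haar[U ⊗ U ⊗ Ū ⊗ Ū]`, entry by entry. -/
structure IsTwoDesign {q : ℕ} (μ : Measure (TwoQuditUnitary q)) : Prop where
  isProbabilityMeasure : IsProbabilityMeasure μ
  moment_eq : ∀ a a' b b' c c' d d' : Fin q × Fin q,
    ∫ U, U.1 a a' * U.1 b b' * star (U.1 c c') * star (U.1 d d') ∂μ =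
      ∫ U, U.1 a a' * U.1 b b' * star (U.1 c c') * star (U.1 d d') ∂(haarProb q)

/-! ### Parameterized gates -/

/-- A parameterized gate `θ ↦ W_l e^{-iAθ} W_r` on (at most) two qudits, with `A` Hermitian,
`W_l`, `W_r` fixed unitaries, and `e^{-iAθ}` periodic in `θ` with period `2π`.
A gate on a single qudit is the special case in which `A`, `W_l`, `W_r` act as the identity on the
other tensor factor. -/
structure ParamGate (q : ℕ) where
  A : Matrix (Fin q × Fin q) (Fin q × Fin q) ℂ
  Wl : TwoQuditUnitary q
  Wr : TwoQuditUnitary q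
  isHermitian : A.IsHermitian
  periodic : Function.Periodic
    (fun θ : ℝ => NormedSpace.exp ((-(Complex.I * (θ : ℂ))) • A)) (2 * Real.pi)

/-- The two-qudit operator `W_l e^{-iAθ} W_r`. -/
def ParamGate.eval {q : ℕ} (G : ParamGate q) (θ : ℝ) :
    Matrix (Fin q × Fin q) (Fin q × Fin q) ℂ :=
  G.Wl.1 * NormedSpace.exp ((-(Complex.I * (θ : ℂ))) • G.A) * G.Wr.1

/-! ### Operators on `n` qudits -/

/-- Operators on `n` qudits of local dimension `q`, in the computational basis. -/
abbrev Op (n q : ℕ) : Type := Matrix (Fin n → Fin q) (Fin n → Fin q) ℂ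

/-- The two-qudit operator `B` acting on the sites `i`, `j` (and as the identity elsewhere). -/
def onSites {n q : ℕ} (i j : Fin n) (B : Matrix (Fin q × Fin q) (Fin q × Fin q) ℂ) : Op n q :=
  Matrix.of fun s t =>
    if ∀ k, k ≠ i → k ≠ j → s k = t k then B (s i, s j) (t i, t j) else 0

/-- The product `F (k-1) * ⋯ * F 1 * F 0`: `F 0` is applied first. -/
def timeProd {ι : Type} [Fintype ι] [DecidableEq ι] {k : ℕ} (F : Fin k → Matrix ι ι ℂ) :
    Matrix ι ι ℂ :=
  (List.ofFn F).reverse.prod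

/-- The operator norm on matrices, with respect to the Euclidean norm on vectors. -/
def opNorm {ι : Type} [Fintype ι] [DecidableEq ι] (B : Matrix ι ι ℂ) : ℝ :=
  ‖Matrix.toEuclideanCLM (𝕜 := ℂ) B‖

/-! ### The ansatz -/

/-- An ansatz of the model on `n` qudits of local dimension `q`. It has `m` random entangling
gates; the `t`-th one acts on the distinct sites `site₁ t`, `site₂ t`, is drawn from the 2-design
`law t`, and is preceded by `nPre t` and succeeded by `nPost t` parameterized gates which act on
one or both of these two sites. Every qudit is acted on by some entangling gate. -/
structure Ansatz (n q : ℕ) where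
  m : ℕ
  site₁ : Fin m → Fin n
  site₂ : Fin m → Fin n
  site_ne : ∀ t, site₁ t ≠ site₂ t
  law : Fin m → Measure (TwoQuditUnitary q)
  isTwoDesign : ∀ t, IsTwoDesign (law t)
  nPre : Fin m → ℕ
  nPost : Fin m → ℕ
  pre : ∀ t, Fin (nPre t) → ParamGate q
  post : ∀ t, Fin (nPost t) → ParamGate q
  covered : ∀ k, ∃ t, k = site₁ t ∨ k = site₂ t

namespace Ansatz

variable {n q : ℕ}

/-- The index set of the parameters: one parameter for each parameterized gate. -/
abbrev Param (C : Ansatz n q) : Type :=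
  Σ t : Fin C.m, Fin (C.nPre t) ⊕ Fin (C.nPost t)

/-- A realization of the entangling gates. -/
abbrev Realization (C : Ansatz n q) : Type :=
  Fin C.m → TwoQuditUnitary q

/-- The parameterized gate with a given index. -/
def gate (C : Ansatz n q) : C.Param → ParamGate q
  | ⟨t, Sum.inl a⟩ => C.pre t a
  | ⟨t, Sum.inr b⟩ => C.post t b

/-- The `t`-th entangling gate together with its preceding and succeeding parameterized gates, as
a two-qudit operator. -/
def block (C : Ansatz n q) (V : C.Realization) (θ : C.Param → ℝ) (t : Fin C.m) :
    Matrix (Fin q × Fin q) (Fin q × Fin q) ℂ :=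
  timeProd (fun b => (C.post t b).eval (θ ⟨t, Sum.inr b⟩)) * (V t).1 *
    timeProd (fun a => (C.pre t a).eval (θ ⟨t, Sum.inl a⟩))

/-- The circuit unitary `U_V(θ)`. -/
def circuit (C : Ansatz n q) (V : C.Realization) (θ : C.Param → ℝ) : Op n q :=
  timeProd fun t => onSites (C.site₁ t) (C.site₂ t) (C.block V θ t)

/-- The matrix element `⟨0ⁿ| U_V(θ)† O U_V(θ) |0ⁿ⟩`. -/
def expval [NeZero q] (C : Ansatz n q) (O : Op n q) (V : C.Realization) (θ : C.Param → ℝ) : ℂ :=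
  ((C.circuit V θ)ᴴ * O * C.circuit V θ) (fun _ => 0) (fun _ => 0)

/-- The objective function `f_V(θ) = ⟨0ⁿ| U_V(θ)† H U_V(θ) |0ⁿ⟩`, real since `H` will be
Hermitian. -/
def objective [NeZero q] (C : Ansatz n q) (H : Op n q) (V : C.Realization) (θ : C.Param → ℝ) : ℝ :=
  (C.expval H V θ).re

/-- The partial derivative of `f_V` at `θ` with respect to the parameter `l`. -/
def partialDeriv [NeZero q] (C : Ansatz n q) (H : Op n q) (V : C.Realization)
    (θ : C.Param → ℝ) (l : C.Param) : ℝ :=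
  deriv (fun s => C.objective H V (Function.update θ l s)) (θ l)

/-- `‖∇ f_V(θ)‖²`. -/
def gradNormSq [NeZero q] (C : Ansatz n q) (H : Op n q) (V : C.Realization)
    (θ : C.Param → ℝ) : ℝ :=
  ∑ l, C.partialDeriv H V θ l ^ 2

/-- The law of the entangling gates: they are independent. -/
def gateLaw (C : Ansatz n q) : Measure C.Realization :=
  Measure.pi C.law

/-- The uniform probability distribution on the parameter space `[0, 2π]^p`. -/
def paramLaw (C : Ansatz n q) : Measure (C.Param → ℝ) :=
  Measure.pi fun _ => ProbabilityTheory.cond volume (Set.Icc 0 (2 * Real.pi))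

/-- The average `E_V E_θ F(V, θ)`. -/
def average (C : Ansatz n q) (F : C.Realization → (C.Param → ℝ) → ℝ) : ℝ :=
  ∫ V, ∫ θ, F V θ ∂C.paramLaw ∂C.gateLaw

end Ansatz

/-! ### Operator bases and the coefficients of an observable -/

/-- `M_0, …, M_{q²-1}` is an orthogonal basis of `ℂ^{q × q}` for the Hilbert-Schmidt inner product
with `M_0 = I` and `tr (M_i† M_j) = q δ_{ij}`. -/
structure IsOperatorBasis {q : ℕ} [NeZero q] (M : Fin (q ^ 2) → Matrix (Fin q) (Fin q) ℂ) :
    Prop where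
  zero_eq : M 0 = 1
  trace_eq : ∀ i j, ((M i)ᴴ * M j).trace = if i = j then (q : ℂ) else 0

/-- The tensor product `M_x = M_{x_1} ⊗ ⋯ ⊗ M_{x_n}`. -/
def tensorOp {n q : ℕ} (M : Fin (q ^ 2) → Matrix (Fin q) (Fin q) ℂ) (x : Fin n → Fin (q ^ 2)) :
    Op n q :=
  Matrix.of fun s t => ∏ k, M (x k) (s k) (t k)

/-- The weight `|x|`: the number of nonzero entries of `x`. -/
def weight {n q : ℕ} [NeZero q] (x : Fin n → Fin (q ^ 2)) : ℕ :=
  (Finset.univ.filter fun k => x k ≠ 0).card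

/-- The coefficient `c_x = q^{-n} tr (M_x† H)` of `H` with respect to the operators `M_x`. -/
def coeff {n q : ℕ} (M : Fin (q ^ 2) → Matrix (Fin q) (Fin q) ℂ) (H : Op n q)
    (x : Fin n → Fin (q ^ 2)) : ℂ :=
  ((q : ℂ) ^ n)⁻¹ * ((tensorOp M x)ᴴ * H).trace

/-- `g_x = E_V E_θ |⟨0ⁿ| U_V(θ)† M_x U_V(θ) |0ⁿ⟩|²`. -/
def Ansatz.g {n q : ℕ} [NeZero q] (C : Ansatz n q) (M : Fin (q ^ 2) → Matrix (Fin q) (Fin q) ℂ)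
    (x : Fin n → Fin (q ^ 2)) : ℝ :=
  C.average fun V θ => ‖C.expval (tensorOp M x) V θ‖ ^ 2

end BarrenPlateau

end

noncomputable section

namespace BarrenPlateau

/-! ### Ordered products -/

section TimeProd

variable {ι : Type} [Fintype ι] [DecidableEq ι]

/-! For fixed parameters, `|⟨0|U†OU|0⟩|²` is linear in `U ⊗ U ⊗ Ū ⊗ Ū`. By independence, the mean of
this tensor is the ordered product of the means of the single gates. The parameterized gates next to
an entangling gate are fixed unitaries on the same pair of sites, and the twirl absorbs them. The
bound thus holds for each `θ` separately, and the average over `θ` adds nothing to the second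
moment.

By Schur–Weyl duality for two copies (`exists_eq_of_lift4_invariant`), the mean of one gate sends
any tensor on its pair of sites to a combination of identity and swap, determined by the two
pairings with identity and swap. On one site, normalize identity and swap to have identity pairing
`1`; their swap pairings are then `1/q` and `q`. Give a product tensor with swap pairings `m k` the
potential `∏ (1 + m k)`. As long as every `m k` lies in `[1/q, q]`, a twirl produces a nonnegative
combination of two product tensors whose total potential is no larger (`isPairTwirl_expect`). The
input `|0ⁿ⟩` has all `m k = 1`, hence potential `2^n`. Since every site is touched, the output is a
nonnegative combination of products of normalized identities and swaps, with total potential at most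
`2^n` (`re_dotProduct_timeProd_le`).

On such a product the functional of `M_x` is `1` if swaps cover the support of `x`, and `0`
otherwise; different `x` do not interfere. Site by site, this indicator is at most `q^{-|x|}
(q/(q+1))^n` times the potential (`prod_indicator_le`). For `|x| ≥ n/2` the second moment of `M_x`
is therefore at most `(2√q/(q+1))^n`. This base is strictly below `1` and is at most `q^{-1/16}` for
all `q ≥ 2`.

For the gradient, let `h` be `f_V` as a function of one parameter. Over a period, integration by
parts gives `∫ h'² = -∫ h h'' ≤ sup |h''| ∫ |h|`. Two commutators with the generator give `|h''| ≤
4‖A‖²‖H‖`, and `E|f| ≤ (E f²)^{1/2}` reduces the claim to the second moment. -/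

theorem timeProd_zero (F : Fin 0 → Matrix ι ι ℂ) : timeProd F = 1 := by
  simp [timeProd]

theorem timeProd_succ {k : ℕ} (F : Fin (k + 1) → Matrix ι ι ℂ) :
    timeProd F = timeProd (fun t => F t.succ) * F 0 := by
  simp [timeProd, List.ofFn_succ]

theorem timeProd_mem_unitary {k : ℕ} {F : Fin k → Matrix ι ι ℂ}
    (hF : ∀ t, F t ∈ Matrix.unitaryGroup ι ℂ) : timeProd F ∈ Matrix.unitaryGroup ι ℂ := by
  induction k with
  | zero => rw [timeProd_zero]; exact one_mem _
  | succ k ih =>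
    rw [timeProd_succ]
    exact mul_mem (ih fun t => hF t.succ) (hF 0)

theorem timeProd_map {κ : Type} [Fintype κ] [DecidableEq κ] (φ : Matrix ι ι ℂ → Matrix κ κ ℂ)
    (h1 : φ 1 = 1) (hmul : ∀ A B, φ (A * B) = φ A * φ B) {k : ℕ} (F : Fin k → Matrix ι ι ℂ) :
    φ (timeProd F) = timeProd fun t => φ (F t) := by
  induction k with
  | zero => rw [timeProd_zero, timeProd_zero, h1]
  | succ k ih => rw [timeProd_succ, timeProd_succ, hmul, ih]

/-- An ordered product of unitaries depends on each single factor through multiplication by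
unitaries from the left and from the right. -/
theorem exists_timeProd_update {k : ℕ} {F : Fin k → Matrix ι ι ℂ}
    (hF : ∀ t, F t ∈ Matrix.unitaryGroup ι ℂ) (t : Fin k) :
    ∃ P ∈ Matrix.unitaryGroup ι ℂ, ∃ Q ∈ Matrix.unitaryGroup ι ℂ,
      ∀ X, timeProd (Function.update F t X) = P * X * Q := by
  induction k with
  | zero => exact t.elim0
  | succ k ih =>
    refine Fin.cases ?_ (fun t => ?_) t
    · refine ⟨timeProd fun t => F t.succ, timeProd_mem_unitary fun t => hF t.succ, 1, one_mem _,
        fun X => ?_⟩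
      rw [timeProd_succ]
      simp
    · obtain ⟨P, hP, Q, hQ, h⟩ := ih (F := fun t => F t.succ) (fun t => hF t.succ) t
      refine ⟨P, hP, Q * F 0, mul_mem hQ (hF 0), fun X => ?_⟩
      have e : (fun u => Function.update F t.succ X (Fin.succ u)) =
          Function.update (fun u => F u.succ) t X := by
        funext u
        by_cases hu : u = t
        · subst hu; simp
        · rw [Function.update_of_ne hu, Function.update_of_ne ((Fin.succ_injective k).ne hu)]
      rw [timeProd_succ, ← mul_assoc, ← h X, e, Function.update_of_ne (Fin.succ_ne_zero t).symm]

theorem continuous_timeProd {X : Type*} [TopologicalSpace X] {k : ℕ}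
    {F : Fin k → X → Matrix ι ι ℂ} (hF : ∀ t, Continuous (F t)) :
    Continuous fun x => timeProd fun t => F t x := by
  induction k with
  | zero => simp only [timeProd_zero]; exact continuous_const
  | succ k ih =>
    simp only [timeProd_succ]
    exact (ih fun t => hF t.succ).mul (hF 0)

end TimeProd

/-! ### Operators on two sites -/

section OnSites

variable {n q : ℕ}

/-- The configuration `s` with the entries at `i` and `j` replaced. -/
def updatePair (i j : Fin n) (s : Fin n → Fin q) (p : Fin q × Fin q) : Fin n → Fin q :=
  Function.update (Function.update s i p.1) j p.2

theorem updatePair_left {i j : Fin n} (hij : i ≠ j) (s : Fin n → Fin q) (p : Fin q × Fin q) :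
    updatePair i j s p i = p.1 := by
  simp [updatePair, hij]

theorem updatePair_right (i j : Fin n) (s : Fin n → Fin q) (p : Fin q × Fin q) :
    updatePair i j s p j = p.2 := by
  simp [updatePair]

theorem updatePair_of_ne {i j k : Fin n} (hi : k ≠ i) (hj : k ≠ j) (s : Fin n → Fin q)
    (p : Fin q × Fin q) : updatePair i j s p k = s k := by
  simp [updatePair, hi, hj]

theorem eq_updatePair_iff {i j : Fin n} (hij : i ≠ j) (s t : Fin n → Fin q) (p : Fin q × Fin q) :
    t = updatePair i j s p ↔ (∀ k, k ≠ i → k ≠ j → s k = t k) ∧ p = (t i, t j) := by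
  constructor
  · rintro rfl
    refine ⟨fun k hi hj => (updatePair_of_ne hi hj s p).symm, ?_⟩
    rw [updatePair_left hij, updatePair_right]
  · rintro ⟨h, rfl⟩
    funext k
    by_cases hj : k = j
    · subst hj; rw [updatePair_right]
    by_cases hi : k = i
    · subst hi; rw [updatePair_left hij]
    rw [updatePair_of_ne hi hj, h k hi hj]

theorem onSites_apply (i j : Fin n) (B : Matrix (Fin q × Fin q) (Fin q × Fin q) ℂ)
    (s t : Fin n → Fin q) : onSites i j B s t =
      if ∀ k, k ≠ i → k ≠ j → s k = t k then B (s i, s j) (t i, t j) else 0 := rfl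

theorem sum_onSites_mul {i j : Fin n} (hij : i ≠ j)
    (B : Matrix (Fin q × Fin q) (Fin q × Fin q) ℂ) (s : Fin n → Fin q)
    (g : (Fin n → Fin q) → ℂ) :
    ∑ t, onSites i j B s t * g t = ∑ p, B (s i, s j) p * g (updatePair i j s p) := by
  have h : ∀ p, B (s i, s j) p * g (updatePair i j s p) =
      ∑ t, if t = updatePair i j s p then B (s i, s j) p * g t else 0 := fun p => by simp
  simp only [h]
  rw [Finset.sum_comm]
  refine Finset.sum_congr rfl fun t _ => ?_
  simp only [eq_updatePair_iff hij, onSites_apply]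
  by_cases ht : ∀ k, k ≠ i → k ≠ j → s k = t k
  · rw [if_pos ht]
    simp only [and_iff_right ht]
    simp
  · simp only [ht, if_false, false_and, zero_mul, Finset.sum_const_zero]

theorem onSites_mul {i j : Fin n} (hij : i ≠ j)
    (B C : Matrix (Fin q × Fin q) (Fin q × Fin q) ℂ) :
    onSites i j (B * C) = onSites i j B * onSites i j C := by
  ext s t
  rw [Matrix.mul_apply, sum_onSites_mul hij, onSites_apply]
  have h : ∀ p, (∀ k, k ≠ i → k ≠ j → updatePair i j s p k = t k) ↔
      ∀ k, k ≠ i → k ≠ j → s k = t k := fun p =>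
    forall_congr' fun k => forall_congr' fun hi => forall_congr' fun hj => by
      rw [updatePair_of_ne hi hj]
  simp only [onSites_apply, h, updatePair_left hij, updatePair_right]
  split_ifs with ht
  · rw [Matrix.mul_apply]
  · simp

theorem onSites_one (i j : Fin n) :
    onSites i j (1 : Matrix (Fin q × Fin q) (Fin q × Fin q) ℂ) = 1 := by
  ext s t
  rw [onSites_apply, Matrix.one_apply, Matrix.one_apply]
  by_cases h : s = t
  · subst h; simp
  · rw [if_neg h]
    split_ifs with h1 h2
    · refine absurd (funext fun k => ?_) h
      by_cases hi : k = i
      · subst hi; exact congrArg Prod.fst h2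
      by_cases hj : k = j
      · subst hj; exact congrArg Prod.snd h2
      exact h1 k hi hj
    · rfl
    · rfl

theorem onSites_conjTranspose (i j : Fin n) (B : Matrix (Fin q × Fin q) (Fin q × Fin q) ℂ) :
    onSites i j Bᴴ = (onSites i j B)ᴴ := by
  ext s t
  simp only [Matrix.conjTranspose_apply, onSites_apply, eq_comm (a := s _)]
  split_ifs <;> simp

theorem onSites_add (i j : Fin n) (B C : Matrix (Fin q × Fin q) (Fin q × Fin q) ℂ) :
    onSites i j (B + C) = onSites i j B + onSites i j C := by
  ext s t
  simp only [Matrix.add_apply, onSites_apply]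
  split_ifs <;> simp

theorem onSites_smul (i j : Fin n) (c : ℂ) (B : Matrix (Fin q × Fin q) (Fin q × Fin q) ℂ) :
    onSites i j (c • B) = c • onSites i j B := by
  ext s t
  simp only [Matrix.smul_apply, onSites_apply]
  split_ifs <;> simp

/-- Operators on the sites `i`, `j` form a star subalgebra of all operators. -/
def onSitesHom {i j : Fin n} (hij : i ≠ j) :
    Matrix (Fin q × Fin q) (Fin q × Fin q) ℂ →⋆ₐ[ℂ] Op n q where
  toFun := onSites i j
  map_one' := onSites_one i j
  map_mul' := onSites_mul hij
  map_zero' := by simpa using onSites_smul i j 0 (0 : Matrix (Fin q × Fin q) (Fin q × Fin q) ℂ)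
  map_add' := onSites_add i j
  commutes' c := by
    rw [Algebra.algebraMap_eq_smul_one, Algebra.algebraMap_eq_smul_one, onSites_smul, onSites_one]
  map_star' := onSites_conjTranspose i j

theorem onSites_mem_unitary {i j : Fin n} (hij : i ≠ j)
    {B : Matrix (Fin q × Fin q) (Fin q × Fin q) ℂ}
    (hB : B ∈ Matrix.unitaryGroup (Fin q × Fin q) ℂ) :
    onSites i j B ∈ Matrix.unitaryGroup (Fin n → Fin q) ℂ := by
  rw [Matrix.mem_unitaryGroup_iff, Matrix.star_eq_conjTranspose] at hB ⊢
  rw [← onSites_conjTranspose, ← onSites_mul hij, hB, onSites_one]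

theorem continuous_onSites (i j : Fin n) :
    Continuous (onSites i j : Matrix (Fin q × Fin q) (Fin q × Fin q) ℂ → Op n q) := by
  refine continuous_matrix fun s t => ?_
  simp only [onSites_apply]
  split_ifs
  · exact continuous_id.matrix_elem _ _
  · exact continuous_const

end OnSites

/-! ### Fourth tensor powers -/

section Lift

variable {ι : Type}

open scoped Kronecker in
/-- `B ⊗ B ⊗ B̄ ⊗ B̄`. -/
def lift4 (B : Matrix ι ι ℂ) : Matrix (ι × ι × ι × ι) (ι × ι × ι × ι) ℂ :=
  B ⊗ₖ (B ⊗ₖ (B.map star ⊗ₖ B.map star))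

theorem lift4_apply (B : Matrix ι ι ℂ) (a b : ι × ι × ι × ι) :
    lift4 B a b = B a.1 b.1 * B a.2.1 b.2.1 * star (B a.2.2.1 b.2.2.1) *
      star (B a.2.2.2 b.2.2.2) := by
  simp [lift4, Matrix.kroneckerMap_apply, mul_assoc]

theorem map_star_mul [Fintype ι] (A B : Matrix ι ι ℂ) : (A * B).map star = A.map star * B.map star := by
  ext i j
  simp [Matrix.mul_apply]

theorem lift4_one [DecidableEq ι] : lift4 (1 : Matrix ι ι ℂ) = 1 := by
  simp [lift4]

theorem lift4_mul [Fintype ι] (A B : Matrix ι ι ℂ) : lift4 (A * B) = lift4 A * lift4 B := by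
  simp only [lift4, map_star_mul, Matrix.mul_kronecker_mul]

theorem continuous_lift4 : Continuous (lift4 : Matrix ι ι ℂ → _) := by
  refine continuous_matrix fun a b => ?_
  simp only [lift4_apply]
  have h : ∀ i j, Continuous fun B : Matrix ι ι ℂ => B i j := fun i j =>
    continuous_id.matrix_elem i j
  exact (((h _ _).mul (h _ _)).mul (h _ _).star).mul (h _ _).star

end Lift

/-! ### Vectors invariant under all `U ⊗ U ⊗ Ū ⊗ Ū` -/

section Invariant

variable {ι : Type} [DecidableEq ι]

/-- The identity on `ℂ^ι ⊗ ℂ^ι`, as a tensor with four indices. -/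
def idTensor (e : ι × ι × ι × ι) : ℂ := if e.1 = e.2.2.1 ∧ e.2.1 = e.2.2.2 then 1 else 0

/-- The swap of the two factors of `ℂ^ι ⊗ ℂ^ι`, as a tensor with four indices. -/
def swapTensor (e : ι × ι × ι × ι) : ℂ := if e.1 = e.2.2.2 ∧ e.2.1 = e.2.2.1 then 1 else 0

theorem idTensor_eq_mul (a b c d : ι) :
    idTensor (a, b, c, d) = (if a = c then 1 else 0) * (if b = d then 1 else 0) := by
  simp only [idTensor]; split_ifs <;> simp_all

theorem swapTensor_eq_mul (a b c d : ι) :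
    swapTensor (a, b, c, d) = (if a = d then 1 else 0) * (if b = c then 1 else 0) := by
  simp only [swapTensor]; split_ifs <;> simp_all

theorem exists_perm_map_pair {a b c d : ι} (hab : a ≠ b) (hcd : c ≠ d) :
    ∃ σ : Equiv.Perm ι, σ a = c ∧ σ b = d := by
  refine ⟨(Equiv.swap (Equiv.swap a c b) d) * Equiv.swap a c, ?_, ?_⟩
  · simp only [Equiv.Perm.mul_apply, Equiv.swap_apply_left]
    refine Equiv.swap_apply_of_ne_of_ne ?_ hcd
    intro h
    have : Equiv.swap a c a = Equiv.swap a c b := by rw [Equiv.swap_apply_left]; exact h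
    exact hab ((Equiv.swap a c).injective this)
  · simp [Equiv.Perm.mul_apply]

variable [Fintype ι]

theorem sum_star_mul_of_unitary {U : Matrix ι ι ℂ} (hU : U ∈ Matrix.unitaryGroup ι ℂ) (f g : ι) :
    ∑ e, U e f * star (U e g) = if f = g then 1 else 0 := by
  have h := congrFun (congrFun (Matrix.mem_unitaryGroup_iff'.mp hU) g) f
  rw [Matrix.mul_apply, Matrix.one_apply] at h
  simp only [Matrix.star_apply] at h
  simp only [mul_comm (U _ f), h, eq_comm (a := g)]

/-- Orthonormality of the columns contracts each `U` with a `Ū`. Invariance as a row vector is what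
makes the pairing with the identity, and likewise with the swap, survive averaging over gates. -/
theorem idTensor_vecMul_lift4 {U : Matrix ι ι ℂ} (hU : U ∈ Matrix.unitaryGroup ι ℂ) :
    idTensor ᵥ* lift4 U = idTensor := by
  funext ⟨f1, f2, f3, f4⟩
  simp only [Matrix.vecMul, dotProduct, Fintype.sum_prod_type, lift4_apply, idTensor_eq_mul]
  rw [← sum_star_mul_of_unitary hU f1 f3, ← sum_star_mul_of_unitary hU f2 f4, Finset.sum_mul_sum]
  refine Finset.sum_congr rfl fun a _ => Finset.sum_congr rfl fun b _ => ?_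
  simp
  ring

theorem swapTensor_vecMul_lift4 {U : Matrix ι ι ℂ} (hU : U ∈ Matrix.unitaryGroup ι ℂ) :
    swapTensor ᵥ* lift4 U = swapTensor := by
  funext ⟨f1, f2, f3, f4⟩
  simp only [Matrix.vecMul, dotProduct, Fintype.sum_prod_type, lift4_apply, swapTensor_eq_mul]
  rw [← sum_star_mul_of_unitary hU f1 f4, ← sum_star_mul_of_unitary hU f2 f3, Finset.sum_mul_sum]
  refine Finset.sum_congr rfl fun a _ => Finset.sum_congr rfl fun b _ => ?_
  simp
  ring

theorem idTensor_dotProduct_idTensor :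
    (idTensor : ι × ι × ι × ι → ℂ) ⬝ᵥ idTensor = (Fintype.card ι : ℂ) ^ 2 := by
  simp [dotProduct, Fintype.sum_prod_type, idTensor_eq_mul, sq]

theorem idTensor_dotProduct_swapTensor :
    (idTensor : ι × ι × ι × ι → ℂ) ⬝ᵥ swapTensor = Fintype.card ι := by
  simp [dotProduct, Fintype.sum_prod_type, idTensor_eq_mul, swapTensor_eq_mul]

theorem swapTensor_dotProduct_swapTensor :
    (swapTensor : ι × ι × ι × ι → ℂ) ⬝ᵥ swapTensor = (Fintype.card ι : ℂ) ^ 2 := by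
  simp [dotProduct, Fintype.sum_prod_type, swapTensor_eq_mul, sq]

open scoped Kronecker in
/-- A vector fixed by `P ⊗ P ⊗ P̄ ⊗ P̄`, read as an operator on `ℂ^ι ⊗ ℂ^ι`, commutes with
`P ⊗ P`. -/
theorem commute_of_lift4_mulVec_eq {P : Matrix ι ι ℂ} (hP : P ∈ Matrix.unitaryGroup ι ℂ)
    {y : ι × ι × ι × ι → ℂ} (hy : lift4 P *ᵥ y = y) (a b c d : ι) :
    ∑ f, ∑ g, P a f * P b g * y (f, g, c, d) = ∑ f, ∑ g, P f c * P g d * y (a, b, f, g) := by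
  have hPP : Pᵀ * P.map star = 1 := by
    have h := congrArg Matrix.transpose (Matrix.mem_unitaryGroup_iff'.mp hP)
    rwa [Matrix.transpose_mul, Matrix.star_eq_conjTranspose, Matrix.conjTranspose,
      Matrix.transpose_one, ← Matrix.transpose_map, Matrix.transpose_transpose] at h
  -- Multiplying the invariance equation by `1 ⊗ 1 ⊗ Pᵀ ⊗ Pᵀ` cancels the two conjugate factors,
  -- because `Pᵀ P̄ = 1`.
  have h : ((1 : Matrix ι ι ℂ) ⊗ₖ ((1 : Matrix ι ι ℂ) ⊗ₖ (Pᵀ ⊗ₖ Pᵀ))) *ᵥ y =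
      (P ⊗ₖ (P ⊗ₖ ((1 : Matrix ι ι ℂ) ⊗ₖ (1 : Matrix ι ι ℂ)))) *ᵥ y := by
    conv_lhs => rw [← hy]
    rw [Matrix.mulVec_mulVec, lift4]
    simp only [← Matrix.mul_kronecker_mul, hPP, Matrix.one_mul]
  have h' := congrFun h (a, b, c, d)
  simp only [Matrix.mulVec, dotProduct, Fintype.sum_prod_type, Matrix.kroneckerMap_apply,
    Matrix.one_apply, Matrix.transpose_apply] at h'
  simpa [mul_assoc, Finset.sum_ite_eq, ← Finset.mul_sum] using h'.symm

theorem eq_of_lift4_diagonal {y : ι × ι × ι × ι → ℂ}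
    (hy : ∀ P ∈ Matrix.unitaryGroup ι ℂ, lift4 P *ᵥ y = y) {u : ι → ℂ}
    (hu : ∀ z, u z * star (u z) = 1) (a b c d : ι) (h0 : y (a, b, c, d) ≠ 0) :
    u a * u b = u c * u d := by
  have hP : Matrix.diagonal u ∈ Matrix.unitaryGroup ι ℂ := by
    rw [Matrix.mem_unitaryGroup_iff, Matrix.star_eq_conjTranspose,
      Matrix.diagonal_conjTranspose, Matrix.diagonal_mul_diagonal, ← Matrix.diagonal_one]
    congr 1
    exact funext hu
  have h := commute_of_lift4_mulVec_eq hP (hy _ hP) a b c d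
  simp only [Matrix.diagonal_apply, mul_ite, ite_mul, mul_zero, zero_mul, Finset.sum_ite_eq,
    Finset.sum_ite_eq', Finset.mem_univ, if_true] at h
  exact mul_right_cancel₀ h0 h

/-- Diagonal phases detect the multiset of indices: a phase `i` at a single index `z` multiplies `y
(a, b, c, d)` by `i` to the difference of the multiplicities of `z` in `{a, b}` and `{c, d}`.
Multiplicities are at most `2`, and `1, i, -1` are distinct, so they must agree. Testing `z = a` and
`z = b` suffices. -/
theorem support_of_lift4_invariant {y : ι × ι × ι × ι → ℂ}
    (hy : ∀ P ∈ Matrix.unitaryGroup ι ℂ, lift4 P *ᵥ y = y) (a b c d : ι)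
    (h0 : y (a, b, c, d) ≠ 0) : (a = c ∧ b = d) ∨ (a = d ∧ b = c) := by
  have hI : Complex.I ≠ 1 := by
    intro h; simpa using congrArg Complex.re h
  have hI' : (-1 : ℂ) ≠ 1 := by norm_num
  have hI2 : (-1 : ℂ) ≠ Complex.I := by
    intro h; simpa using congrArg Complex.im h
  have key : ∀ z, (if a = z then Complex.I else 1) * (if b = z then Complex.I else 1) =
      (if c = z then Complex.I else 1) * (if d = z then Complex.I else 1) := fun z =>
    eq_of_lift4_diagonal hy (u := fun a => if a = z then Complex.I else 1)
      (fun w => by split_ifs <;> simp) a b c d h0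
  have h1 := key a
  have h2 := key b
  by_cases hab : a = b <;> by_cases hac : a = c <;> by_cases had : a = d <;>
    by_cases hbc : b = c <;> by_cases hbd : b = d <;> simp_all [eq_comm]

theorem perm_of_lift4_invariant {y : ι × ι × ι × ι → ℂ}
    (hy : ∀ P ∈ Matrix.unitaryGroup ι ℂ, lift4 P *ᵥ y = y) (σ : Equiv.Perm ι) (a b c d : ι) :
    y (σ a, σ b, σ c, σ d) = y (a, b, c, d) := by
  have hP : σ.permMatrix ℂ ∈ Matrix.unitaryGroup ι ℂ := by
    rw [Matrix.mem_unitaryGroup_iff, Matrix.star_eq_conjTranspose, Matrix.conjTranspose_permMatrix,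
      ← Matrix.permMatrix_mul]
    simp
  have h := commute_of_lift4_mulVec_eq hP (hy _ hP) a b (σ c) (σ d)
  simpa [Equiv.Perm.permMatrix, PEquiv.toMatrix_apply, Equiv.toPEquiv_apply] using h

/-- Phases and permutations leave three free values: on the diagonal, on the identity pattern and on
the swap pattern. One unitary mixing two basis vectors supplies the remaining linear relation. -/
theorem diag_of_lift4_invariant {y : ι × ι × ι × ι → ℂ}
    (hy : ∀ P ∈ Matrix.unitaryGroup ι ℂ, lift4 P *ᵥ y = y) {a b : ι} (hab : a ≠ b) :
    y (a, a, a, a) = y (a, b, a, b) + y (b, a, a, b) := by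
  set S : Matrix ι ι ℂ := (Equiv.swap a b).permMatrix ℂ with hS
  have hSH : Sᴴ = S := by rw [hS, Matrix.conjTranspose_permMatrix, Equiv.swap_inv]
  have hSS : S * S = 1 := by rw [hS, ← Matrix.permMatrix_mul]; simp
  -- A combination of `1` and the transposition `S` is unitary here because `(3/5)² + (4/5)² = 1`
  -- and the cross terms cancel through the factor `i`. Both coefficients being nonzero makes the
  -- relation below nontrivial.
  set P : Matrix ι ι ℂ := (3 / 5 : ℂ) • 1 + (4 / 5 * Complex.I : ℂ) • S with hPdef
  have hP : P ∈ Matrix.unitaryGroup ι ℂ := by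
    rw [Matrix.mem_unitaryGroup_iff, Matrix.star_eq_conjTranspose, hPdef]
    simp only [Matrix.conjTranspose_add, Matrix.conjTranspose_smul, hSH, Matrix.conjTranspose_one,
      add_mul, mul_add, smul_mul_assoc, mul_smul_comm, hSS, one_mul, mul_one]
    have e1 : star (3 / 5 : ℂ) = 3 / 5 := by simp
    have e2 : star (4 / 5 * Complex.I : ℂ) = -(4 / 5 * Complex.I) := by simp
    rw [e1, e2]
    have : (4 / 5 * Complex.I) * -(4 / 5 * Complex.I) = (16 / 25 : ℂ) := by
      linear_combination (-16 / 25 : ℂ) * Complex.I_mul_I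
    rw [smul_add, smul_add, smul_smul, smul_smul, smul_smul, smul_smul,
      mul_comm (-(4 / 5 * Complex.I)) (4 / 5 * Complex.I), this]
    module
  have hPa : ∀ f, P a f = (if f = a then 3 / 5 else 0) + if f = b then 4 / 5 * Complex.I else 0 := by
    intro f
    simp [hPdef, hS, Equiv.Perm.permMatrix, PEquiv.toMatrix_apply, Equiv.toPEquiv_apply,
      Matrix.one_apply, eq_comm]
  have hPt : ∀ f g, P f g = P g f := by
    intro f g
    have : S f g = S g f := by
      conv_lhs => rw [← hSH]
      simp [hS, Equiv.Perm.permMatrix, PEquiv.toMatrix_apply]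
    simp [hPdef, this, Matrix.one_apply, eq_comm]
  have hz : ∀ c d e f, ¬((c = e ∧ d = f) ∨ (c = f ∧ d = e)) → y (c, d, e, f) = 0 :=
    fun c d e f => not_imp_comm.mp (support_of_lift4_invariant hy c d e f)
  -- At this entry the support condition leaves two terms on the left and one on the right, all with
  -- the same factor `P a a * P a b = 12/25 i`.
  have h := commute_of_lift4_mulVec_eq hP (hy _ hP) a a a b
  have hl : ∑ f, ∑ g, P a f * P a g * y (f, g, a, b) =
      12 / 25 * Complex.I * (y (a, b, a, b) + y (b, a, a, b)) := by
    simp only [hPa, add_mul, mul_add, ite_mul, mul_ite, zero_mul, mul_zero,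
      Finset.sum_add_distrib, Finset.sum_ite_eq', Finset.mem_univ, if_true]
    rw [hz a a a b (by tauto), hz b b a b (by tauto)]
    ring
  have hr : ∑ f, ∑ g, P f a * P g b * y (a, a, f, g) =
      12 / 25 * Complex.I * y (a, a, a, a) := by
    rw [Finset.sum_eq_single a, Finset.sum_eq_single a]
    · rw [hPa, hPa]; simp [hab, hab.symm]; ring_nf; simp
    · intro g _ hg; rw [hz a a a g (by tauto), mul_zero]
    · simp
    · intro f _ hf
      exact Finset.sum_eq_zero fun g _ => by rw [hz a a f g (by tauto), mul_zero]
    · simp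
  rw [hl, hr] at h
  exact (mul_left_cancel₀ (by simp) h).symm

/-- Schur–Weyl duality for two factors: the only invariant vectors are the combinations of the
identity and the swap. -/
theorem exists_eq_of_lift4_invariant [Nontrivial ι] {y : ι × ι × ι × ι → ℂ}
    (hy : ∀ P ∈ Matrix.unitaryGroup ι ℂ, lift4 P *ᵥ y = y) :
    ∃ α β : ℂ, y = α • idTensor + β • swapTensor := by
  obtain ⟨a, b, hab⟩ := exists_pair_ne ι
  refine ⟨y (a, b, a, b), y (b, a, a, b), ?_⟩
  funext ⟨c, d, e, f⟩
  simp only [Pi.add_apply, Pi.smul_apply, smul_eq_mul, idTensor, swapTensor]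
  by_cases h1 : c = e ∧ d = f
  · obtain ⟨rfl, rfl⟩ := h1
    by_cases hcd : c = d
    · subst hcd
      simp only [and_self, if_true, mul_one]
      rw [← diag_of_lift4_invariant hy hab]
      have := perm_of_lift4_invariant hy (Equiv.swap a c) a a a a
      simpa using this
    · obtain ⟨σ, rfl, rfl⟩ := exists_perm_map_pair hab hcd
      rw [perm_of_lift4_invariant hy]
      simp [hab]
  · by_cases h2 : c = f ∧ d = e
    · obtain ⟨rfl, rfl⟩ := h2
      have hcd : c ≠ d := fun h => h1 ⟨h, h.symm⟩
      obtain ⟨σ, rfl, rfl⟩ := exists_perm_map_pair hab.symm hcd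
      rw [perm_of_lift4_invariant hy]
      simp [hab, hab.symm]
    · rw [if_neg h1, if_neg h2, not_imp_comm.mp (support_of_lift4_invariant hy c d e f) (by tauto)]
      simp

/-- This inverts the Gram matrix of identity and swap, with diagonal entries `N²` and off-diagonal
entries `N`; its determinant `N²(N² - 1)` is nonzero for `N ≥ 2`. -/
theorem coefficients_of_pairings {y : ι × ι × ι × ι → ℂ} {α β : ℂ}
    (hι : 2 ≤ Fintype.card ι) (hy : y = α • idTensor + β • swapTensor) :
    α = (Fintype.card ι * (idTensor ⬝ᵥ y) - swapTensor ⬝ᵥ y) /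
        (Fintype.card ι * ((Fintype.card ι : ℂ) ^ 2 - 1)) ∧
    β = (Fintype.card ι * (swapTensor ⬝ᵥ y) - idTensor ⬝ᵥ y) /
        (Fintype.card ι * ((Fintype.card ι : ℂ) ^ 2 - 1)) := by
  have h1 : idTensor ⬝ᵥ y = α * (Fintype.card ι : ℂ) ^ 2 + β * Fintype.card ι := by
    rw [hy, dotProduct_add, dotProduct_smul, dotProduct_smul, idTensor_dotProduct_idTensor,
      idTensor_dotProduct_swapTensor, smul_eq_mul, smul_eq_mul]
  have h2 : swapTensor ⬝ᵥ y = α * Fintype.card ι + β * (Fintype.card ι : ℂ) ^ 2 := by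
    rw [hy, dotProduct_add, dotProduct_smul, dotProduct_smul, dotProduct_comm swapTensor,
      swapTensor_dotProduct_swapTensor, idTensor_dotProduct_swapTensor, smul_eq_mul, smul_eq_mul]
  have hN : (Fintype.card ι : ℂ) ≠ 0 := by
    have : Fintype.card ι ≠ 0 := by omega
    exact_mod_cast this
  have hN2 : (Fintype.card ι : ℂ) ^ 2 - 1 ≠ 0 := by
    have : Fintype.card ι ^ 2 ≠ 1 := by nlinarith
    exact sub_ne_zero.mpr (by exact_mod_cast this)
  rw [h1, h2]
  constructor <;> field_simp <;> ring

end Invariant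

/-! ### Expectations of random matrices -/

section Expectation

variable {Ω : Type*} [MeasurableSpace Ω] {ι κ τ : Type}

/-- The entrywise expectation of a random matrix. -/
def expect (μ : Measure Ω) (F : Ω → Matrix ι κ ℂ) : Matrix ι κ ℂ :=
  Matrix.of fun i j => ∫ ω, F ω i j ∂μ

theorem expect_apply (μ : Measure Ω) (F : Ω → Matrix ι κ ℂ) (i : ι) (j : κ) :
    expect μ F i j = ∫ ω, F ω i j ∂μ := rfl

variable {μ : Measure Ω} {F : Ω → Matrix ι κ ℂ}

theorem expect_mul_left [Fintype ι] (hF : ∀ i j, Integrable (fun ω => F ω i j) μ)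
    (A : Matrix τ ι ℂ) : expect μ (fun ω => A * F ω) = A * expect μ F := by
  ext i j
  simp only [expect_apply, Matrix.mul_apply]
  rw [integral_finsetSum _ fun k _ => (hF k j).const_mul _]
  exact Finset.sum_congr rfl fun k _ => integral_const_mul _ _

theorem expect_mul_right [Fintype κ] (hF : ∀ i j, Integrable (fun ω => F ω i j) μ)
    (A : Matrix κ τ ℂ) : expect μ (fun ω => F ω * A) = expect μ F * A := by
  ext i j
  simp only [expect_apply, Matrix.mul_apply]
  rw [integral_finsetSum _ fun k _ => (hF i k).mul_const _]
  exact Finset.sum_congr rfl fun k _ => integral_mul_const _ _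

theorem integral_mulVec [Fintype κ] (hF : ∀ i j, Integrable (fun ω => F ω i j) μ)
    (x : κ → ℂ) (i : ι) : ∫ ω, (F ω *ᵥ x) i ∂μ = (expect μ F *ᵥ x) i := by
  simp only [expect_apply, Matrix.mulVec, dotProduct]
  rw [integral_finsetSum _ fun k _ => (hF i k).mul_const _]
  exact Finset.sum_congr rfl fun k _ => integral_mul_const _ _

end Expectation

theorem integrable_of_continuous {X E : Type*} [TopologicalSpace X] [CompactSpace X]
    [MeasurableSpace X] [OpensMeasurableSpace X] [NormedAddCommGroup E] {μ : Measure X}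
    [IsFiniteMeasure μ] [SecondCountableTopologyEither X E]
    {f : X → E} (hf : Continuous f) : Integrable f μ := by
  obtain ⟨C, hC⟩ := (isCompact_range hf).isBounded.exists_norm_le
  exact Integrable.of_bound hf.aestronglyMeasurable C
    (Filter.Eventually.of_forall fun x => hC _ ⟨x, rfl⟩)

/-! ### The twirl by a unitary 2-design -/

section Twirl

variable {q : ℕ}

instance : SecondCountableTopology (Matrix (Fin q × Fin q) (Fin q × Fin q) ℂ) :=
  inferInstanceAs (SecondCountableTopology (Fin q × Fin q → Fin q × Fin q → ℂ))

instance : SecondCountableTopology (TwoQuditUnitary q) :=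
  Topology.IsEmbedding.subtypeVal.secondCountableTopology

instance : IsProbabilityMeasure (haarProb q) := by
  constructor
  simpa [haarProb] using
    Measure.haarMeasure_self (K₀ := (⊤ : TopologicalSpace.PositiveCompacts (TwoQuditUnitary q)))

instance : (haarProb q).IsMulLeftInvariant := by
  unfold haarProb; infer_instance

theorem integrable_lift4 (μ : Measure (TwoQuditUnitary q)) [IsProbabilityMeasure μ] (a b) :
    Integrable (fun V : TwoQuditUnitary q => lift4 V.1 a b) μ :=
  integrable_of_continuous ((continuous_lift4.comp continuous_subtype_val).matrix_elem a b)

theorem lift4_mul_expect_haar {P : Matrix (Fin q × Fin q) (Fin q × Fin q) ℂ}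
    (hP : P ∈ Matrix.unitaryGroup (Fin q × Fin q) ℂ) :
    lift4 P * expect (haarProb q) (fun V => lift4 V.1) =
      expect (haarProb q) (fun V => lift4 V.1) := by
  rw [← expect_mul_left (integrable_lift4 _)]
  ext a b
  simp only [expect_apply, ← lift4_mul]
  exact integral_mul_left_eq_self (μ := haarProb q)
    (fun V : TwoQuditUnitary q => lift4 V.1 a b) (⟨P, hP⟩ : TwoQuditUnitary q)

theorem IsTwoDesign.expect_lift4 {μ : Measure (TwoQuditUnitary q)} (hμ : IsTwoDesign μ) :
    expect μ (fun V => lift4 V.1) = expect (haarProb q) (fun V => lift4 V.1) := by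
  ext a b
  simp only [expect_apply, lift4_apply]
  exact hμ.moment_eq _ _ _ _ _ _ _ _

theorem card_pair (q : ℕ) : Fintype.card (Fin q × Fin q) = q ^ 2 := by
  simp [sq]

/-- The average of `U ⊗ U ⊗ Ū ⊗ Ū` over a unitary 2-design, also when `U` is conjugated by fixed
unitaries. -/
theorem IsTwoDesign.expect_lift4_mulVec (hq : 2 ≤ q) {μ : Measure (TwoQuditUnitary q)}
    (hμ : IsTwoDesign μ) {P Q : Matrix (Fin q × Fin q) (Fin q × Fin q) ℂ}
    (hP : P ∈ Matrix.unitaryGroup (Fin q × Fin q) ℂ)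
    (hQ : Q ∈ Matrix.unitaryGroup (Fin q × Fin q) ℂ)
    (x : (Fin q × Fin q) × (Fin q × Fin q) × (Fin q × Fin q) × (Fin q × Fin q) → ℂ) :
    expect μ (fun V => lift4 (P * V.1 * Q)) *ᵥ x =
      (((q : ℂ) ^ 2 * (idTensor ⬝ᵥ x) - swapTensor ⬝ᵥ x) /
        ((q : ℂ) ^ 2 * (((q : ℂ) ^ 2) ^ 2 - 1))) • idTensor +
      (((q : ℂ) ^ 2 * (swapTensor ⬝ᵥ x) - idTensor ⬝ᵥ x) /
        ((q : ℂ) ^ 2 * (((q : ℂ) ^ 2) ^ 2 - 1))) • swapTensor := by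
  have := hμ.isProbabilityMeasure
  have hcard : 2 ≤ Fintype.card (Fin q × Fin q) := by rw [card_pair]; nlinarith
  have : Nontrivial (Fin q × Fin q) := Fintype.one_lt_card_iff_nontrivial.mp hcard
  have hint : ∀ a b, Integrable (fun V : TwoQuditUnitary q => (lift4 V.1 * lift4 Q) a b) μ :=
    fun a b => integrable_of_continuous (by
      simp only [← lift4_mul]
      exact (continuous_lift4.comp
        (continuous_subtype_val.mul continuous_const)).matrix_elem a b)
  -- Left invariance of Haar measure absorbs `P`. The factor `Q` stays, and is removed below because
  -- only pairings with the invariant row vectors matter.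
  have hE : expect μ (fun V => lift4 (P * V.1 * Q)) =
      expect (haarProb q) (fun V => lift4 V.1) * lift4 Q := by
    simp only [lift4_mul, mul_assoc]
    rw [expect_mul_left hint, expect_mul_right (integrable_lift4 μ), hμ.expect_lift4,
      ← mul_assoc, lift4_mul_expect_haar hP]
  rw [hE]
  set E := expect (haarProb q) (fun V => lift4 V.1) with hEdef
  have hinv : ∀ R ∈ Matrix.unitaryGroup (Fin q × Fin q) ℂ,
      lift4 R *ᵥ ((E * lift4 Q) *ᵥ x) = (E * lift4 Q) *ᵥ x := fun R hR => by
    rw [Matrix.mulVec_mulVec, ← mul_assoc, lift4_mul_expect_haar hR]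
  obtain ⟨α, β, h⟩ := exists_eq_of_lift4_invariant hinv
  have hpair : ∀ w : (Fin q × Fin q) × (Fin q × Fin q) × (Fin q × Fin q) × (Fin q × Fin q) → ℂ,
      (∀ R ∈ Matrix.unitaryGroup (Fin q × Fin q) ℂ, w ᵥ* lift4 R = w) →
      w ⬝ᵥ ((E * lift4 Q) *ᵥ x) = w ⬝ᵥ x := by
    intro w hw
    have hwE : w ᵥ* E = w := by
      have : ∀ b, (w ᵥ* E) b = ∫ V, (w ᵥ* lift4 V.1) b ∂(haarProb q) := by
        intro b
        simp only [Matrix.vecMul, dotProduct, hEdef, expect_apply]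
        rw [integral_finsetSum _ fun k _ => (integrable_lift4 _ k b).const_mul _]
        exact Finset.sum_congr rfl fun k _ => (integral_const_mul _ _).symm
      funext b
      rw [this]
      have h2 : ∀ V : TwoQuditUnitary q, (w ᵥ* lift4 V.1) b = w b := fun V => by
        rw [hw V.1 V.2]
      simp [h2]
    rw [Matrix.dotProduct_mulVec, ← Matrix.vecMul_vecMul, hwE, hw Q hQ]
  obtain ⟨hα, hβ⟩ := coefficients_of_pairings hcard h
  rw [hpair _ fun R hR => idTensor_vecMul_lift4 hR,
    hpair _ fun R hR => swapTensor_vecMul_lift4 hR, card_pair] at hα hβ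
  push_cast at hα hβ
  rw [h, hα, hβ]

end Twirl

/-! ### Independence -/

section Independence

variable {ι Ω : Type} [Fintype ι] [DecidableEq ι] [MeasurableSpace Ω]

/-- Fubini for one factor at a time: the gate with index `0` is the rightmost factor, and each entry
of the product is a finite sum of products of independent variables. -/
theorem expect_timeProd {k : ℕ} (μ : Fin k → Measure Ω) [∀ t, IsProbabilityMeasure (μ t)]
    (F : Fin k → Ω → Matrix ι ι ℂ) (hF : ∀ t i j, Integrable (fun ω => F t ω i j) (μ t)) :
    (∀ i j, Integrable (fun V : Fin k → Ω => timeProd (fun t => F t (V t)) i j)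
      (Measure.pi μ)) ∧
    expect (Measure.pi μ) (fun V => timeProd fun t => F t (V t)) =
      timeProd fun t => expect (μ t) (F t) := by
  induction k with
  | zero =>
    simp only [timeProd_zero]
    refine ⟨fun i j => integrable_const _, ?_⟩
    ext i j
    simp [expect_apply]
  | succ k ih =>
    obtain ⟨ih1, ih2⟩ := ih (fun t => μ t.succ) (fun t => F t.succ) fun t => hF t.succ
    have hmp := (measurePreserving_piFinSuccAbove μ 0)
    have hfun : ∀ i j, (fun V : Fin (k + 1) → Ω => timeProd (fun t => F t (V t)) i j) =
        (fun p : Ω × (Fin k → Ω) =>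
          ∑ l, F 0 p.1 l j * timeProd (fun t => F t.succ (p.2 t)) i l) ∘
          MeasurableEquiv.piFinSuccAbove (fun _ => Ω) 0 := by
      intro i j
      funext V
      simp only [timeProd_succ, Matrix.mul_apply, Function.comp]
      exact Finset.sum_congr rfl fun l _ => mul_comm _ _
    have hint : ∀ i j l, Integrable (fun p : Ω × (Fin k → Ω) =>
        F 0 p.1 l j * timeProd (fun t => F t.succ (p.2 t)) i l)
        ((μ 0).prod (Measure.pi fun t => μ (Fin.succ t))) := fun i j l =>
      (hF 0 l j).mul_prod (ih1 i l)
    refine ⟨fun i j => ?_, ?_⟩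
    · rw [hfun]
      exact hmp.integrable_comp_of_integrable (integrable_finsetSum _ fun l _ => hint i j l)
    · ext i j
      rw [timeProd_succ, ← ih2, Matrix.mul_apply, expect_apply, hfun]
      refine (hmp.integral_comp' (g := fun p : Ω × (Fin k → Ω) =>
          ∑ l, F 0 p.1 l j * timeProd (fun t => F t.succ (p.2 t)) i l)).trans ?_
      refine (integral_finsetSum _ fun l _ => hint i j l).trans ?_
      refine Finset.sum_congr rfl fun l _ => ?_
      refine (integral_prod_mul (fun ω => F 0 ω l j)
        fun V : Fin k → Ω => timeProd (fun t => F t.succ (V t)) i l).trans ?_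
      rw [mul_comm]
      rfl

end Independence

/-! ### Product tensors and the action of a random gate on them -/

section ProductTensor

variable {n q : ℕ}

/-- Tensors with four indices. -/
abbrev Tensor4 (ι : Type) : Type := ι × ι × ι × ι → ℂ

/-- The entries of four configurations at a site. -/
def quadAt {ι : Type} (s : (ι → Fin q) × (ι → Fin q) × (ι → Fin q) × (ι → Fin q)) (k : ι) :
    Fin q × Fin q × Fin q × Fin q :=
  (s.1 k, s.2.1 k, s.2.2.1 k, s.2.2.2 k)

/-- The tensor product of a family of site tensors. -/
def prodTensor (τ : Fin n → Tensor4 (Fin q)) : Tensor4 (Fin n → Fin q) :=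
  fun s => ∏ k, τ k (quadAt s k)

/-- The tensor product of two site tensors. -/
def pairTensor (σ τ : Tensor4 (Fin q)) : Tensor4 (Fin q × Fin q) := fun e =>
  σ (e.1.1, e.2.1.1, e.2.2.1.1, e.2.2.2.1) * τ (e.1.2, e.2.1.2, e.2.2.1.2, e.2.2.2.2)

/-- The normalized identity of a site. -/
def siteId : Tensor4 (Fin q) := ((q : ℂ) ^ 2)⁻¹ • idTensor

/-- The normalized swap of a site. -/
def siteSwap : Tensor4 (Fin q) := (q : ℂ)⁻¹ • swapTensor

/-- Replace the values at `i` and `j` by a common value. -/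
def setPair {α : Type} (i j : Fin n) (a : α) (f : Fin n → α) : Fin n → α :=
  Function.update (Function.update f i a) j a

theorem prod_eq_pair_mul {M : Type*} [CommMonoid M] {i j : Fin n} (hij : i ≠ j) (f : Fin n → M) :
    ∏ k, f k = f i * f j * ∏ k ∈ (Finset.univ.erase i).erase j, f k := by
  rw [mul_assoc, Finset.mul_prod_erase _ _ (by simp [hij.symm]), Finset.mul_prod_erase _ _ (by simp)]

theorem setPair_left {α : Type} {i j : Fin n} (a : α) (f : Fin n → α) :
    setPair i j a f i = a := by
  by_cases h : i = j <;> simp [setPair, h]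

theorem setPair_right {α : Type} {i j : Fin n} (a : α) (f : Fin n → α) :
    setPair i j a f j = a := by
  simp [setPair]

theorem setPair_of_ne {α : Type} {i j k : Fin n} (hi : k ≠ i) (hj : k ≠ j) (a : α)
    (f : Fin n → α) : setPair i j a f k = f k := by
  simp [setPair, hi, hj]

/-- A two-site gate sees only the two tensor factors at its sites. This reduces its average to the
twirl on a single pair of qudits. -/
theorem lift4_onSites_mulVec {i j : Fin n} (hij : i ≠ j)
    (B : Matrix (Fin q × Fin q) (Fin q × Fin q) ℂ) (τ : Fin n → Tensor4 (Fin q))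
    (s : (Fin n → Fin q) × (Fin n → Fin q) × (Fin n → Fin q) × (Fin n → Fin q)) :
    (lift4 (onSites i j B) *ᵥ prodTensor τ) s =
      (∏ k ∈ (Finset.univ.erase i).erase j, τ k (quadAt s k)) *
        (lift4 B *ᵥ pairTensor (τ i) (τ j)) ((s.1 i, s.1 j), (s.2.1 i, s.2.1 j),
          (s.2.2.1 i, s.2.2.1 j), (s.2.2.2 i, s.2.2.2 j)) := by
  obtain ⟨s1, s2, s3, s4⟩ := s
  have hstar : ∀ (s : Fin n → Fin q) (g : (Fin n → Fin q) → ℂ),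
      ∑ t, star (onSites i j B s t) * g t =
        ∑ p, star (B (s i, s j) p) * g (updatePair i j s p) := by
    intro s g
    have h : ∀ t, star (onSites i j B s t) = onSites i j (B.map star) s t := by
      intro t
      simp only [onSites_apply, Matrix.map_apply]
      split_ifs <;> simp
    simp only [h, sum_onSites_mul hij, Matrix.map_apply]
  simp only [Matrix.mulVec, dotProduct, lift4_apply, Fintype.sum_prod_type (α₁ := Fin n → Fin q),
    mul_assoc]
  simp only [← Finset.mul_sum, hstar, sum_onSites_mul hij]
  rw [Fintype.sum_prod_type (α₁ := Fin q × Fin q)]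
  simp only [Fintype.sum_prod_type (α₁ := Fin q × Fin q) (α₂ := (Fin q × Fin q) × _)]
  have hval : ∀ p1 p2 p3 p4 : Fin q × Fin q,
      prodTensor τ (updatePair i j s1 p1, updatePair i j s2 p2, updatePair i j s3 p3,
        updatePair i j s4 p4) =
      (∏ k ∈ (Finset.univ.erase i).erase j, τ k (quadAt (s1, s2, s3, s4) k)) *
        pairTensor (τ i) (τ j) (p1, p2, p3, p4) := by
    intro p1 p2 p3 p4
    rw [prodTensor, prod_eq_pair_mul hij, mul_comm]
    congr 1
    · refine Finset.prod_congr rfl fun k hk => ?_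
      simp only [Finset.mem_erase, Finset.mem_univ, and_true] at hk
      simp only [quadAt, updatePair_of_ne hk.2 hk.1]
    · simp only [quadAt, updatePair_left hij, updatePair_right, pairTensor]
  simp only [hval, Finset.mul_sum, Fintype.sum_prod_type (α₁ := Fin q × Fin q)
    (α₂ := (Fin q × Fin q))]
  refine Finset.sum_congr rfl fun p1 _ => Finset.sum_congr rfl fun p2 _ =>
    Finset.sum_congr rfl fun p3 _ => Finset.sum_congr rfl fun p4 _ => ?_
  ring

theorem idTensor_dotProduct {ι : Type} [Fintype ι] [DecidableEq ι] (x : Tensor4 ι) :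
    idTensor ⬝ᵥ x = ∑ a, ∑ b, x (a, b, a, b) := by
  simp [dotProduct, Fintype.sum_prod_type, idTensor_eq_mul, ite_mul]

theorem swapTensor_dotProduct {ι : Type} [Fintype ι] [DecidableEq ι] (x : Tensor4 ι) :
    swapTensor ⬝ᵥ x = ∑ a, ∑ b, x (a, b, b, a) := by
  simp [dotProduct, Fintype.sum_prod_type, swapTensor_eq_mul, ite_mul]

theorem sum_pair_mul_pair (f g : Fin q → Fin q → ℂ) :
    ∑ a : Fin q × Fin q, ∑ b : Fin q × Fin q, f a.1 b.1 * g a.2 b.2 =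
      (∑ a, ∑ b, f a b) * ∑ a, ∑ b, g a b := by
  simp only [Fintype.sum_prod_type, ← Finset.mul_sum, ← Finset.sum_mul]

theorem idTensor_dotProduct_pairTensor (σ τ : Tensor4 (Fin q)) :
    idTensor ⬝ᵥ pairTensor σ τ = (idTensor ⬝ᵥ σ) * (idTensor ⬝ᵥ τ) := by
  simp only [idTensor_dotProduct, pairTensor]
  exact sum_pair_mul_pair (fun a b => σ (a, b, a, b)) fun a b => τ (a, b, a, b)

theorem swapTensor_dotProduct_pairTensor (σ τ : Tensor4 (Fin q)) :
    swapTensor ⬝ᵥ pairTensor σ τ = (swapTensor ⬝ᵥ σ) * (swapTensor ⬝ᵥ τ) := by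
  simp only [swapTensor_dotProduct, pairTensor]
  exact sum_pair_mul_pair (fun a b => σ (a, b, b, a)) fun a b => τ (a, b, b, a)

theorem idTensor_pair (hq : q ≠ 0) (a b c d : Fin q × Fin q) :
    idTensor (a, b, c, d) = (q : ℂ) ^ 4 * (siteId (a.1, b.1, c.1, d.1) *
      siteId (a.2, b.2, c.2, d.2)) := by
  have : (q : ℂ) ≠ 0 := by exact_mod_cast hq
  simp only [siteId, Pi.smul_apply, smul_eq_mul, idTensor_eq_mul, Prod.ext_iff]
  split_ifs <;> first | (field_simp; done) | simp_all

theorem swapTensor_pair (hq : q ≠ 0) (a b c d : Fin q × Fin q) :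
    swapTensor (a, b, c, d) = (q : ℂ) ^ 2 * (siteSwap (a.1, b.1, c.1, d.1) *
      siteSwap (a.2, b.2, c.2, d.2)) := by
  have : (q : ℂ) ≠ 0 := by exact_mod_cast hq
  simp only [siteSwap, Pi.smul_apply, smul_eq_mul, swapTensor_eq_mul, Prod.ext_iff]
  split_ifs <;> first | (field_simp; done) | simp_all

/-- The pairings of a site tensor with the identity and the swap are `1` and `m`, and `m` lies in
the range `[1/q, q]` of density-operator-like tensors. -/
structure IsSiteState (τ : Tensor4 (Fin q)) (m : ℝ) : Prop where
  id_eq : idTensor ⬝ᵥ τ = 1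
  swap_eq : swapTensor ⬝ᵥ τ = m
  le : (q : ℝ)⁻¹ ≤ m
  ge : m ≤ q

theorem isSiteState_siteId (hq : 1 ≤ q) : IsSiteState (siteId : Tensor4 (Fin q)) (q : ℝ)⁻¹ := by
  have h0 : (q : ℂ) ≠ 0 := by exact_mod_cast (by omega : q ≠ 0)
  have h1 : (1 : ℝ) ≤ q := by exact_mod_cast hq
  refine ⟨?_, ?_, le_rfl, (inv_le_one_of_one_le₀ h1).trans h1⟩
  · rw [siteId, dotProduct_smul, idTensor_dotProduct_idTensor, Fintype.card_fin, smul_eq_mul]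
    field_simp
  · rw [siteId, dotProduct_smul, dotProduct_comm, idTensor_dotProduct_swapTensor,
      Fintype.card_fin, smul_eq_mul]
    push_cast
    field_simp

theorem isSiteState_siteSwap (hq : 1 ≤ q) : IsSiteState (siteSwap : Tensor4 (Fin q)) q := by
  have h0 : (q : ℂ) ≠ 0 := by exact_mod_cast (by omega : q ≠ 0)
  have h1 : (1 : ℝ) ≤ q := by exact_mod_cast hq
  refine ⟨?_, ?_, (inv_le_one_of_one_le₀ h1).trans h1, le_rfl⟩
  · rw [siteSwap, dotProduct_smul, idTensor_dotProduct_swapTensor, Fintype.card_fin, smul_eq_mul]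
    field_simp
  · rw [siteSwap, dotProduct_smul, swapTensor_dotProduct_swapTensor,
      Fintype.card_fin, smul_eq_mul]
    push_cast
    field_simp

/-- The tensor of the basis state `|0⟩`. -/
def siteZero [NeZero q] : Tensor4 (Fin q) := Pi.single (0, 0, 0, 0) 1

theorem isSiteState_siteZero [NeZero q] : IsSiteState (siteZero : Tensor4 (Fin q)) 1 := by
  have h1 : (1 : ℝ) ≤ q := by exact_mod_cast NeZero.one_le
  refine ⟨?_, ?_, inv_le_one_of_one_le₀ h1, h1⟩
  · simp [siteZero, idTensor]
  · simp [siteZero, swapTensor]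

/-- `E` turns product tensors into nonnegative combinations of product tensors which are
maximally mixed or swaps at the sites `i` and `j`, without increasing the symmetric weight
`∏ k, (1 + m k)`. -/
def IsPairTwirl (E : Matrix ((Fin n → Fin q) × (Fin n → Fin q) × (Fin n → Fin q) × (Fin n → Fin q))
    ((Fin n → Fin q) × (Fin n → Fin q) × (Fin n → Fin q) × (Fin n → Fin q)) ℂ)
    (i j : Fin n) : Prop :=
  ∀ (τ : Fin n → Tensor4 (Fin q)) (m : Fin n → ℝ), (∀ k, IsSiteState (τ k) (m k)) →
    ∃ a b : ℝ, 0 ≤ a ∧ 0 ≤ b ∧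
      E *ᵥ prodTensor τ = (a : ℂ) • prodTensor (setPair i j siteId τ) +
        (b : ℂ) • prodTensor (setPair i j siteSwap τ) ∧
      a * ∏ k, (1 + setPair i j (q : ℝ)⁻¹ m k) + b * ∏ k, (1 + setPair i j (q : ℝ) m k) ≤
        ∏ k, (1 + m k)

/-- The difference of the two sides is `(qx - 1)(q - y) + (qy - 1)(q - x)`. It vanishes at `x = y =
1/q` and at `x = y = q`, the two outputs of a pair twirl. -/
theorem two_mul_one_add_mul_le {q x y : ℝ} (hq : 0 < q) (hx : q⁻¹ ≤ x) (hx' : x ≤ q)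
    (hy : q⁻¹ ≤ y) (hy' : y ≤ q) : 2 * q * (1 + x * y) ≤ (q ^ 2 + 1) * (x + y) := by
  have h1 : 1 ≤ q * x := by rwa [inv_le_iff_one_le_mul₀' hq] at hx
  have h2 : 1 ≤ q * y := by rwa [inv_le_iff_one_le_mul₀' hq] at hy
  nlinarith [mul_nonneg (sub_nonneg.2 h1) (sub_nonneg.2 hy'),
    mul_nonneg (sub_nonneg.2 h2) (sub_nonneg.2 hx')]

theorem isPairTwirl_expect (hq : 2 ≤ q) {i j : Fin n} (hij : i ≠ j)
    {μ : Measure (TwoQuditUnitary q)} (hμ : IsTwoDesign μ)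
    {P Q : Matrix (Fin q × Fin q) (Fin q × Fin q) ℂ}
    (hP : P ∈ Matrix.unitaryGroup (Fin q × Fin q) ℂ)
    (hQ : Q ∈ Matrix.unitaryGroup (Fin q × Fin q) ℂ) :
    IsPairTwirl (expect μ fun V => lift4 (onSites i j (P * V.1 * Q))) i j := by
  have := hμ.isProbabilityMeasure
  intro τ m hτ
  have hqR : (2 : ℝ) ≤ q := by exact_mod_cast hq
  have hq0 : (0 : ℝ) < q := by linarith
  have hD : (0 : ℝ) < (q : ℝ) ^ 2 * (((q : ℝ) ^ 2) ^ 2 - 1) := by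
    have : 1 < ((q : ℝ) ^ 2) ^ 2 := one_lt_pow₀ (one_lt_pow₀ (by linarith) two_ne_zero) two_ne_zero
    have := sub_pos.2 this
    positivity
  have hmi := (hτ i).le
  have hmj := (hτ j).le
  have hmi0 : 0 < m i := (inv_pos.2 hq0).trans_le hmi
  have hmj0 : 0 < m j := (inv_pos.2 hq0).trans_le hmj
  have hf1 : m i * m j ≤ q ^ 2 := by
    rw [sq]; exact mul_le_mul (hτ i).ge (hτ j).ge hmj0.le hq0.le
  have hf2 : 1 ≤ (q : ℝ) ^ 2 * (m i * m j) := by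
    have h1 : 1 ≤ q * m i := by rwa [inv_le_iff_one_le_mul₀' hq0] at hmi
    have h2 : 1 ≤ q * m j := by rwa [inv_le_iff_one_le_mul₀' hq0] at hmj
    nlinarith
  -- `α` and `β` are the coefficients of the unnormalized identity and swap on the pair, whose
  -- dimension is `q²`. They are nonnegative precisely because `q⁻² ≤ m i * m j ≤ q²`. The factors
  -- `q⁴` and `q²` below pass to the normalized site tensors.
  set α : ℝ := ((q : ℝ) ^ 2 - m i * m j) / ((q : ℝ) ^ 2 * (((q : ℝ) ^ 2) ^ 2 - 1)) with hα
  set β : ℝ := ((q : ℝ) ^ 2 * (m i * m j) - 1) / ((q : ℝ) ^ 2 * (((q : ℝ) ^ 2) ^ 2 - 1)) with hβ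
  have hα0 : 0 ≤ α := div_nonneg (by linarith) hD.le
  have hβ0 : 0 ≤ β := div_nonneg (by linarith) hD.le
  refine ⟨α * (q : ℝ) ^ 4, β * (q : ℝ) ^ 2, by positivity, by positivity, ?_, ?_⟩
  · have hint : ∀ a b, Integrable (fun V : TwoQuditUnitary q =>
        lift4 (onSites i j (P * V.1 * Q)) a b) μ := fun a b => integrable_of_continuous
      ((continuous_lift4.comp ((continuous_onSites i j).comp
        ((continuous_const.mul continuous_subtype_val).mul continuous_const))).matrix_elem a b)
    have hint' : ∀ a b, Integrable (fun V : TwoQuditUnitary q =>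
        lift4 (P * V.1 * Q) a b) μ := fun a b => integrable_of_continuous
      ((continuous_lift4.comp
        ((continuous_const.mul continuous_subtype_val).mul continuous_const)).matrix_elem a b)
    funext s
    rw [← integral_mulVec hint]
    simp only [lift4_onSites_mulVec hij]
    rw [integral_const_mul, integral_mulVec hint', hμ.expect_lift4_mulVec hq hP hQ,
      idTensor_dotProduct_pairTensor, swapTensor_dotProduct_pairTensor, (hτ i).id_eq,
      (hτ j).id_eq, (hτ i).swap_eq, (hτ j).swap_eq]
    simp only [Pi.add_apply, Pi.smul_apply, smul_eq_mul, prodTensor, prod_eq_pair_mul hij,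
      setPair_left, setPair_right, idTensor_pair (show q ≠ 0 by omega),
      swapTensor_pair (show q ≠ 0 by omega)]
    have hrest : ∀ σ : Tensor4 (Fin q),
        ∏ k ∈ (Finset.univ.erase i).erase j, setPair i j σ τ k (quadAt s k) =
        ∏ k ∈ (Finset.univ.erase i).erase j, τ k (quadAt s k) := by
      intro σ
      refine Finset.prod_congr rfl fun k hk => ?_
      simp only [Finset.mem_erase, Finset.mem_univ, and_true] at hk
      rw [setPair_of_ne hk.2 hk.1]
    rw [hrest, hrest, hα, hβ]
    simp only [quadAt]
    push_cast
    ring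
  · simp only [prod_eq_pair_mul hij, setPair_left, setPair_right]
    have hrest : ∀ c : ℝ, ∏ k ∈ (Finset.univ.erase i).erase j, (1 + setPair i j c m k) =
        ∏ k ∈ (Finset.univ.erase i).erase j, (1 + m k) := by
      intro c
      refine Finset.prod_congr rfl fun k hk => ?_
      simp only [Finset.mem_erase, Finset.mem_univ, and_true] at hk
      rw [setPair_of_ne hk.2 hk.1]
    rw [hrest, hrest, ← mul_assoc (α * _), ← mul_assoc (β * _), ← add_mul]
    refine mul_le_mul_of_nonneg_right ?_ (Finset.prod_nonneg fun k _ => ?_)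
    · have hsum : α + β = (1 + m i * m j) / ((q : ℝ) ^ 2 * ((q : ℝ) ^ 2 + 1)) := by
        rw [hα, hβ, ← add_div, div_eq_div_iff hD.ne' (by positivity)]
        ring
      have hle := two_mul_one_add_mul_le hq0 hmi (hτ i).ge hmj (hτ j).ge
      calc α * (q : ℝ) ^ 4 * ((1 + (q : ℝ)⁻¹) * (1 + (q : ℝ)⁻¹)) +
            β * (q : ℝ) ^ 2 * ((1 + (q : ℝ)) * (1 + q))
          = (α + β) * (q : ℝ) ^ 2 * (1 + q) ^ 2 := by field_simp; ring
        _ = (1 + q) ^ 2 * (1 + m i * m j) / ((q : ℝ) ^ 2 + 1) := by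
          rw [hsum]; field_simp
        -- After clearing the denominator and cancelling `(q² + 1)(1 + m i * m j)`, this is exactly
        -- `hle`.
        _ ≤ (1 + m i) * (1 + m j) := by
          rw [div_le_iff₀ (by positivity)]
          nlinarith
    · have := (inv_pos.2 hq0).trans_le (hτ k).le
      linarith

/-- If a linear functional is bounded by a multiple of the symmetric weight on all products of
normalized identities and swaps, then it is so bounded on the image of every product tensor under
a circuit of pair twirls which touches all other sites. -/
theorem re_dotProduct_timeProd_le (hq : 1 ≤ q) (w : Tensor4 (Fin n → Fin q)) {K : ℝ} (hK : 0 ≤ K)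
    (hw : ∀ σ : Fin n → Bool,
      (w ⬝ᵥ prodTensor fun k => bif σ k then siteSwap else siteId).re ≤
        K * ∏ k, (1 + bif σ k then (q : ℝ) else (q : ℝ)⁻¹))
    {r : ℕ} {i j : Fin r → Fin n} {E : Fin r → Matrix _ _ ℂ}
    (hE : ∀ t, IsPairTwirl (E t) (i t) (j t)) {τ : Fin n → Tensor4 (Fin q)} {m : Fin n → ℝ}
    (hτ : ∀ k, IsSiteState (τ k) (m k))
    (hcov : ∀ k, (∃ t, k = i t ∨ k = j t) ∨
      ∃ b, τ k = (bif b then siteSwap else siteId) ∧ m k = bif b then (q : ℝ) else (q : ℝ)⁻¹) :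
    (w ⬝ᵥ (timeProd E *ᵥ prodTensor τ)).re ≤ K * ∏ k, (1 + m k) := by
  induction r generalizing τ m with
  | zero =>
    have h : ∀ k, ∃ b, τ k = (bif b then siteSwap else siteId) ∧
        m k = bif b then (q : ℝ) else (q : ℝ)⁻¹ := fun k =>
      (hcov k).resolve_left fun ⟨t, _⟩ => t.elim0
    choose σ h1 h2 using h
    rw [timeProd_zero, Matrix.one_mulVec]
    simpa only [← h1, ← h2] using hw σ
  | succ r ih =>
    obtain ⟨a, b, ha, hb, hab, hle⟩ := hE 0 τ m hτ
    have step : ∀ c : Bool,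
        (w ⬝ᵥ (timeProd (fun t => E t.succ) *ᵥ prodTensor
          (setPair (i 0) (j 0) (bif c then siteSwap else siteId) τ))).re ≤
        K * ∏ k, (1 + setPair (i 0) (j 0) (bif c then (q : ℝ) else (q : ℝ)⁻¹) m k) := by
      intro c
      have hpair : ∀ k, (k = i 0 ∨ k = j 0) →
          setPair (i 0) (j 0) (bif c then siteSwap else siteId) τ k =
            (bif c then siteSwap else siteId) ∧
          setPair (i 0) (j 0) (bif c then (q : ℝ) else (q : ℝ)⁻¹) m k =
            bif c then (q : ℝ) else (q : ℝ)⁻¹ := by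
        rintro k (rfl | rfl)
        · exact ⟨setPair_left _ _, setPair_left _ _⟩
        · exact ⟨setPair_right _ _, setPair_right _ _⟩
      -- The two sites just twirled now carry an identity or a swap; any other site keeps its tensor
      -- and is either already of this form or touched by a later gate.
      refine ih (fun t => hE t.succ) (fun k => ?_) fun k => ?_
      · by_cases hk : k = i 0 ∨ k = j 0
        · rw [(hpair k hk).1, (hpair k hk).2]
          cases c
          · exact isSiteState_siteId hq
          · exact isSiteState_siteSwap hq
        · push Not at hk
          rw [setPair_of_ne hk.1 hk.2, setPair_of_ne hk.1 hk.2]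
          exact hτ k
      · by_cases hk : k = i 0 ∨ k = j 0
        · exact Or.inr ⟨c, hpair k hk⟩
        · rcases hcov k with ⟨t, ht⟩ | h
          · revert ht
            refine Fin.cases (fun ht => absurd ht hk) (fun t ht => ?_) t
            exact Or.inl ⟨t, ht⟩
          · push Not at hk
            rw [setPair_of_ne hk.1 hk.2, setPair_of_ne hk.1 hk.2]
            exact Or.inr h
    have h0 := step false
    have h1 := step true
    simp only [cond_false, cond_true] at h0 h1
    rw [timeProd_succ, ← Matrix.mulVec_mulVec, hab, Matrix.mulVec_add, Matrix.mulVec_smul,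
      Matrix.mulVec_smul, dotProduct_add, dotProduct_smul, dotProduct_smul, Complex.add_re,
      smul_eq_mul, smul_eq_mul, Complex.re_ofReal_mul, Complex.re_ofReal_mul]
    calc _ ≤ a * (K * ∏ k, (1 + setPair (i 0) (j 0) (q : ℝ)⁻¹ m k)) +
          b * (K * ∏ k, (1 + setPair (i 0) (j 0) (q : ℝ) m k)) :=
          add_le_add (mul_le_mul_of_nonneg_left h0 ha) (mul_le_mul_of_nonneg_left h1 hb)
      _ = K * (a * ∏ k, (1 + setPair (i 0) (j 0) (q : ℝ)⁻¹ m k) +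
          b * ∏ k, (1 + setPair (i 0) (j 0) (q : ℝ) m k)) := by ring
      _ ≤ _ := mul_le_mul_of_nonneg_left hle hK

end ProductTensor

/-! ### Expansion in an operator basis -/

section Basis

variable {n q : ℕ}

theorem sum_prod_apply {κ : Type} [Fintype κ] (f : Fin n → κ → ℂ) :
    ∑ s : Fin n → κ, ∏ k, f k (s k) = ∏ k, ∑ e, f k e := by
  classical
  rw [Finset.prod_univ_sum, Fintype.piFinset_univ]

theorem sum_sum_prod_apply {κ : Type} [Fintype κ] (f : Fin n → κ → κ → ℂ) :
    ∑ s : Fin n → κ, ∑ t : Fin n → κ, ∏ k, f k (s k) (t k) = ∏ k, ∑ a, ∑ b, f k a b :=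
  (Finset.sum_congr rfl fun s _ => sum_prod_apply fun k b => f k (s k) b).trans
    (sum_prod_apply fun k a => ∑ b, f k a b)

theorem sum_prod_quadAt (f : Fin n → Tensor4 (Fin q)) :
    ∑ s, ∏ k, f k (quadAt s k) = ∏ k, ∑ e, f k e := by
  simp only [Fintype.sum_prod_type, quadAt]
  exact (Finset.sum_congr rfl fun s _ => Finset.sum_congr rfl fun t _ =>
    sum_sum_prod_apply fun k c d => f k (s k, t k, c, d)).trans
      (sum_sum_prod_apply fun k a b => ∑ c, ∑ d, f k (a, b, c, d))

theorem coeff_eq_sum (M : Fin (q ^ 2) → Matrix (Fin q) (Fin q) ℂ) (H : Op n q)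
    (x : Fin n → Fin (q ^ 2)) :
    coeff M H x = ((q : ℂ) ^ n)⁻¹ * ∑ s, ∑ t, star (tensorOp M x s t) * H s t := by
  rw [coeff, Matrix.trace, Finset.sum_comm]
  simp [Matrix.mul_apply]

variable [NeZero q] {M : Fin (q ^ 2) → Matrix (Fin q) (Fin q) ℂ}

theorem IsOperatorBasis.sum_mul_star (hM : IsOperatorBasis M) (x y : Fin (q ^ 2)) :
    ∑ a, ∑ b, M x a b * star (M y a b) = if x = y then (q : ℂ) else 0 := by
  have h := hM.trace_eq y x
  rw [Matrix.trace] at h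
  simp only [Matrix.diag_apply, Matrix.mul_apply, Matrix.conjTranspose_apply] at h
  rw [Finset.sum_comm]
  simp only [mul_comm (M x _ _), h, eq_comm]

theorem IsOperatorBasis.sum_diag (hM : IsOperatorBasis M) (x : Fin (q ^ 2)) :
    ∑ a, M x a a = if x = 0 then (q : ℂ) else 0 := by
  rw [← hM.sum_mul_star x 0]
  simp [hM.zero_eq, Matrix.one_apply, apply_ite]

theorem IsOperatorBasis.sum_tensorOp_mul_star (hM : IsOperatorBasis M)
    (x y : Fin n → Fin (q ^ 2)) :
    ∑ s, ∑ t, tensorOp M x s t * star (tensorOp M y s t) =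
      if x = y then (q : ℂ) ^ n else 0 := by
  simp only [tensorOp, Matrix.of_apply, star_prod, ← Finset.prod_mul_distrib]
  rw [sum_sum_prod_apply fun k a b => M (x k) a b * star (M (y k) a b)]
  simp only [hM.sum_mul_star]
  split_ifs with h
  · subst h; simp
  · obtain ⟨k, hk⟩ := Function.ne_iff.mp h
    exact Finset.prod_eq_zero (Finset.mem_univ k) (if_neg hk)

theorem IsOperatorBasis.coeff_tensorOp (hM : IsOperatorBasis M) (x y : Fin n → Fin (q ^ 2)) :
    coeff M (tensorOp M x) y = if x = y then 1 else 0 := by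
  have hq : (q : ℂ) ≠ 0 := by exact_mod_cast NeZero.ne q
  rw [coeff_eq_sum]
  simp only [mul_comm (star _), hM.sum_tensorOp_mul_star]
  split_ifs
  · exact inv_mul_cancel₀ (pow_ne_zero _ hq)
  · simp

/-- The operators `M_x` form a basis. -/
theorem IsOperatorBasis.sum_coeff_mul (hM : IsOperatorBasis M) (H : Op n q)
    (s t : Fin n → Fin q) : ∑ x, coeff M H x * tensorOp M x s t = H s t := by
  have hq : (q : ℂ) ≠ 0 := by exact_mod_cast NeZero.ne q
  let A : Matrix (Fin n → Fin (q ^ 2)) ((Fin n → Fin q) × (Fin n → Fin q)) ℂ :=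
    Matrix.of fun x p => tensorOp M x p.1 p.2
  have hAA : A * (((q : ℂ) ^ n)⁻¹ • Aᴴ) = 1 := by
    ext x y
    rw [Matrix.mul_smul, Matrix.smul_apply, Matrix.mul_apply, Fintype.sum_prod_type]
    simp only [A, Matrix.conjTranspose_apply, Matrix.of_apply, hM.sum_tensorOp_mul_star,
      Matrix.one_apply]
    split_ifs
    · exact inv_mul_cancel₀ (pow_ne_zero _ hq)
    · simp
  -- The family has as many members as matrix units, `(q²)^n = q^n q^n`, so the one-sided inverse
  -- given by orthogonality is two-sided. The opposite product is the completeness relation.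
  have e : (Fin n → Fin (q ^ 2)) ≃ (Fin n → Fin q) × (Fin n → Fin q) :=
    Fintype.equivOfCardEq (by simp [← mul_pow, sq])
  have hA := (Matrix.mul_eq_one_comm_of_equiv e).mp hAA
  have h : ∀ s' t', ∑ x, ((q : ℂ) ^ n)⁻¹ * star (tensorOp M x s' t') * tensorOp M x s t =
      if s' = s ∧ t' = t then 1 else 0 := by
    intro s' t'
    have := congrFun (congrFun hA (s', t')) (s, t)
    simpa [Matrix.mul_apply, Matrix.one_apply, A] using this
  calc ∑ x, coeff M H x * tensorOp M x s t
      = ∑ x, ∑ s', ∑ t', H s' t' *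
          (((q : ℂ) ^ n)⁻¹ * star (tensorOp M x s' t') * tensorOp M x s t) := by
        refine Finset.sum_congr rfl fun x _ => ?_
        rw [coeff_eq_sum, Finset.mul_sum, Finset.sum_mul]
        refine Finset.sum_congr rfl fun s' _ => ?_
        rw [Finset.mul_sum, Finset.sum_mul]
        refine Finset.sum_congr rfl fun t' _ => ?_
        ring
    _ = ∑ s', ∑ t', H s' t' * ∑ x,
          ((q : ℂ) ^ n)⁻¹ * star (tensorOp M x s' t') * tensorOp M x s t := by
        rw [Finset.sum_comm]
        refine Finset.sum_congr rfl fun s' _ => ?_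
        rw [Finset.sum_comm]
        simp only [Finset.mul_sum]
    _ = H s t := by
        simp only [h, ite_and]
        simp

end Basis

/-! ### The second moment of an expectation value -/

section SecondMoment

variable {n q : ℕ}

/-- The functional `ρ ⊗ ρ' ↦ tr (O ρ) · tr (O'† ρ')`, as a tensor. -/
def opTensor {ι : Type} (O O' : Matrix ι ι ℂ) : Tensor4 ι :=
  fun a => O a.2.2.1 a.1 * star (O' a.2.1 a.2.2.2)

/-- Expanding `z z̄` uses two copies of `U` and two of `Ū`. The quadratic quantity becomes linear in
`lift4 U`, so that expectations can be taken inside. -/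
theorem norm_sq_eq_opTensor_dotProduct {ι : Type} [Fintype ι] [DecidableEq ι]
    (O U : Matrix ι ι ℂ) (z : ι) :
    ((‖(Uᴴ * O * U) z z‖ ^ 2 : ℝ) : ℂ) =
      opTensor O O ⬝ᵥ (lift4 U *ᵥ Pi.single (z, z, z, z) 1) := by
  have h1 : (Uᴴ * O * U) z z = ∑ a, ∑ c, star (U c z) * O c a * U a z := by
    simp [Matrix.mul_apply, Finset.sum_mul]
  have h2 : star ((Uᴴ * O * U) z z) = ∑ b, ∑ d, U b z * star (O b d) * star (U d z) := by
    rw [h1, Finset.sum_comm]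
    simp [star_sum, mul_comm]
  have h3 : ((‖(Uᴴ * O * U) z z‖ ^ 2 : ℝ) : ℂ) = (Uᴴ * O * U) z z * star ((Uᴴ * O * U) z z) := by
    push_cast
    exact (Complex.mul_conj' _).symm
  rw [h3, h2, h1, Matrix.mulVec_single_one, Finset.sum_mul_sum]
  simp only [dotProduct, Fintype.sum_prod_type, Matrix.col_apply, lift4_apply, opTensor]
  refine Finset.sum_congr rfl fun a _ => Finset.sum_congr rfl fun b _ => ?_
  rw [Finset.sum_mul_sum]
  refine Finset.sum_congr rfl fun c _ => Finset.sum_congr rfl fun d _ => ?_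
  ring

variable [NeZero q] {M : Fin (q ^ 2) → Matrix (Fin q) (Fin q) ℂ}

theorem opTensor_dotProduct_siteId (hM : IsOperatorBasis M) (x y : Fin (q ^ 2)) :
    ∑ e, opTensor (M x) (M y) e * siteId e = if x = 0 ∧ y = 0 then 1 else 0 := by
  have hq : (q : ℂ) ≠ 0 := by exact_mod_cast NeZero.ne q
  have h : ∑ e, opTensor (M x) (M y) e * siteId e =
      ((q : ℂ) ^ 2)⁻¹ * (idTensor ⬝ᵥ opTensor (M x) (M y)) := by
    simp only [siteId, Pi.smul_apply, smul_eq_mul, dotProduct, Finset.mul_sum]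
    exact Finset.sum_congr rfl fun e _ => by ring
  rw [h, idTensor_dotProduct]
  simp only [opTensor]
  rw [← Finset.sum_mul_sum, ← star_sum, hM.sum_diag, hM.sum_diag]
  by_cases hx : x = 0 <;> by_cases hy : y = 0 <;> simp [hx, hy]
  field_simp

theorem opTensor_dotProduct_siteSwap (hM : IsOperatorBasis M) (x y : Fin (q ^ 2)) :
    ∑ e, opTensor (M x) (M y) e * siteSwap e = if x = y then 1 else 0 := by
  have hq : (q : ℂ) ≠ 0 := by exact_mod_cast NeZero.ne q
  have h : ∑ e, opTensor (M x) (M y) e * siteSwap e =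
      (q : ℂ)⁻¹ * (swapTensor ⬝ᵥ opTensor (M x) (M y)) := by
    simp only [siteSwap, Pi.smul_apply, smul_eq_mul, dotProduct, Finset.mul_sum]
    exact Finset.sum_congr rfl fun e _ => by ring
  rw [h, swapTensor_dotProduct]
  simp only [opTensor]
  rw [Finset.sum_comm, hM.sum_mul_star]
  split_ifs <;> simp [hq]

/-- At an identity site only `M_0` has nonzero trace; at a swap site the functional is the
normalized Hilbert–Schmidt product. Either way a site with `x k ≠ y k` contributes zero, so the
second moment has no cross terms between basis operators. -/
theorem opTensor_tensorOp_dotProduct (hM : IsOperatorBasis M) (x y : Fin n → Fin (q ^ 2))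
    (σ : Fin n → Bool) :
    opTensor (tensorOp M x) (tensorOp M y) ⬝ᵥ
        prodTensor (fun k => bif σ k then siteSwap else siteId) =
      if x = y then ((∏ k, if σ k ∨ x k = 0 then 1 else 0 : ℝ) : ℂ) else 0 := by
  have h : opTensor (tensorOp M x) (tensorOp M y) ⬝ᵥ
        prodTensor (fun k => bif σ k then siteSwap else siteId) =
      ∏ k, ∑ e, opTensor (M (x k)) (M (y k)) e * (bif σ k then siteSwap else siteId) e := by
    rw [← sum_prod_quadAt (fun k e =>
      opTensor (M (x k)) (M (y k)) e * (bif σ k then siteSwap else siteId) e)]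
    refine Finset.sum_congr rfl fun s _ => ?_
    rw [opTensor, prodTensor, Finset.prod_mul_distrib]
    congr 1
    simp only [tensorOp, Matrix.of_apply, star_prod, ← Finset.prod_mul_distrib]
    rfl
  rw [h]
  have hk : ∀ k, ∑ e, opTensor (M (x k)) (M (y k)) e * (bif σ k then siteSwap else siteId) e =
      if σ k then (if x k = y k then 1 else 0) else if x k = 0 ∧ y k = 0 then 1 else 0 := by
    intro k
    cases σ k
    · simpa using opTensor_dotProduct_siteId hM (x k) (y k)
    · simpa using opTensor_dotProduct_siteSwap hM (x k) (y k)
  simp only [hk]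
  split_ifs with hxy
  · subst hxy
    push_cast
    refine Finset.prod_congr rfl fun k _ => ?_
    by_cases hx : x k = 0 <;> cases σ k <;> simp [hx]
  · obtain ⟨k, hk⟩ := Function.ne_iff.mp hxy
    refine Finset.prod_eq_zero (Finset.mem_univ k) ?_
    cases σ k
    · have : ¬(x k = 0 ∧ y k = 0) := fun h => hk (h.1.trans h.2.symm)
      simp [this]
    · simp [hk]

theorem opTensor_dotProduct_prodTensor (hM : IsOperatorBasis M) (O : Op n q)
    (σ : Fin n → Bool) :
    (opTensor O O ⬝ᵥ prodTensor (fun k => bif σ k then siteSwap else siteId)).re =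
      ∑ x, ‖coeff M O x‖ ^ 2 * ∏ k, if σ k ∨ x k = 0 then 1 else 0 := by
  have hO : opTensor O O = ∑ x, ∑ y, (coeff M O x * star (coeff M O y)) •
      opTensor (tensorOp M x) (tensorOp M y) := by
    funext a
    simp only [opTensor, Finset.sum_apply, Pi.smul_apply, smul_eq_mul]
    rw [← hM.sum_coeff_mul O a.2.2.1 a.1, ← hM.sum_coeff_mul O a.2.1 a.2.2.2, star_sum,
      Finset.sum_mul_sum]
    refine Finset.sum_congr rfl fun x _ => Finset.sum_congr rfl fun y _ => ?_
    rw [star_mul']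
    ring
  rw [hO]
  simp only [sum_dotProduct, smul_dotProduct, opTensor_tensorOp_dotProduct hM, smul_eq_mul,
    mul_ite, mul_zero, Finset.sum_ite_eq, Finset.mem_univ, if_true, Complex.re_sum]
  refine Finset.sum_congr rfl fun x _ => ?_
  have : coeff M O x * star (coeff M O x) = ((‖coeff M O x‖ ^ 2 : ℝ) : ℂ) := by
    push_cast
    exact Complex.mul_conj' _
  rw [this, ← Complex.ofReal_mul, Complex.ofReal_re]

/-- The inequality holds factor by factor. With `q/(q+1)` included, the potential of a site is `1`
for the identity and `q` for the swap; where `x k ≠ 0` only the swap counts, and the factor `q⁻¹`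
compensates it exactly. -/
theorem prod_indicator_le (x : Fin n → Fin (q ^ 2)) (σ : Fin n → Bool) :
    (∏ k, if σ k ∨ x k = 0 then (1 : ℝ) else 0) ≤
      (q : ℝ)⁻¹ ^ weight x * ((q : ℝ) / (q + 1)) ^ n *
        ∏ k, (1 + bif σ k then (q : ℝ) else (q : ℝ)⁻¹) := by
  have hq1 : (1 : ℝ) ≤ q := by exact_mod_cast NeZero.one_le
  have hq0 : (0 : ℝ) < q := by linarith
  have hw : (q : ℝ)⁻¹ ^ weight x = ∏ k, if x k ≠ 0 then (q : ℝ)⁻¹ else 1 := by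
    rw [weight, Finset.prod_ite, Finset.prod_const, Finset.prod_const_one, mul_one]
  have hc : ((q : ℝ) / (q + 1)) ^ n = ∏ _k : Fin n, (q : ℝ) / (q + 1) := by
    rw [Finset.prod_const, Finset.card_univ, Fintype.card_fin]
  rw [hw, hc, ← Finset.prod_mul_distrib, ← Finset.prod_mul_distrib]
  refine Finset.prod_le_prod (fun k _ => by split_ifs <;> norm_num) fun k _ => ?_
  have h1 : (q : ℝ) / (q + 1) * (1 + (q : ℝ)⁻¹) = 1 := by field_simp
  have h2 : (q : ℝ) / (q + 1) * (1 + q) = q := by field_simp; ring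
  by_cases hx : x k = 0 <;> cases hσ : σ k <;>
    simp only [hx, ne_eq, not_true_eq_false, not_false_eq_true, if_true, if_false, or_true, or_false, Bool.false_eq_true, cond_true, cond_false, one_mul, mul_assoc, h1, h2]
  · exact le_rfl
  · exact hq1
  · simp [hq0.le]
  · rw [inv_mul_cancel₀ hq0.ne']

/-- The weight of a global observable on the products of normalized identities and swaps. -/
theorem re_opTensor_dotProduct_le (hM : IsOperatorBasis M) (O : Op n q)
    (hO : ∀ x, coeff M O x ≠ 0 → (n : ℝ) / 2 ≤ (weight x : ℝ)) (σ : Fin n → Bool) :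
    (opTensor O O ⬝ᵥ prodTensor (fun k => bif σ k then siteSwap else siteId)).re ≤
      ((Real.sqrt (q : ℝ)⁻¹ * ((q : ℝ) / (q + 1))) ^ n * ∑ x, ‖coeff M O x‖ ^ 2) *
        ∏ k, (1 + bif σ k then (q : ℝ) else (q : ℝ)⁻¹) := by
  have hq1 : (1 : ℝ) ≤ q := by exact_mod_cast NeZero.one_le
  have hq0 : (0 : ℝ) < q := by linarith
  have hprod : 0 ≤ ∏ k, (1 + bif σ k then (q : ℝ) else (q : ℝ)⁻¹) :=
    Finset.prod_nonneg fun k _ => by cases σ k <;> simp <;> positivity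
  rw [opTensor_dotProduct_prodTensor hM, Finset.mul_sum, Finset.sum_mul]
  refine Finset.sum_le_sum fun x _ => ?_
  by_cases hx : coeff M O x = 0
  · simp [hx]
  have hwt : n ≤ 2 * weight x := by
    have := hO x hx
    have h2 : (n : ℝ) ≤ ((2 * weight x : ℕ) : ℝ) := by push_cast; linarith
    exact_mod_cast h2
  have hpow : (q : ℝ)⁻¹ ^ weight x ≤ Real.sqrt (q : ℝ)⁻¹ ^ n := by
    have h1 : (q : ℝ)⁻¹ ^ weight x = Real.sqrt (q : ℝ)⁻¹ ^ (2 * weight x) := by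
      rw [pow_mul, Real.sq_sqrt (by positivity)]
    rw [h1]
    refine pow_le_pow_of_le_one (Real.sqrt_nonneg _) ?_ hwt
    exact Real.sqrt_le_one.mpr (inv_le_one_of_one_le₀ hq1)
  calc _ ≤ ‖coeff M O x‖ ^ 2 * ((q : ℝ)⁻¹ ^ weight x * ((q : ℝ) / (q + 1)) ^ n *
        ∏ k, (1 + bif σ k then (q : ℝ) else (q : ℝ)⁻¹)) :=
        mul_le_mul_of_nonneg_left (prod_indicator_le x σ) (sq_nonneg _)
    _ ≤ ‖coeff M O x‖ ^ 2 * (Real.sqrt (q : ℝ)⁻¹ ^ n * ((q : ℝ) / (q + 1)) ^ n *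
        ∏ k, (1 + bif σ k then (q : ℝ) else (q : ℝ)⁻¹)) := by gcongr
    _ = _ := by rw [mul_pow]; ring

/-- The numerical bound behind the exponential decay. -/
theorem two_mul_sqrt_inv_mul_le {q : ℝ} (hq : 2 ≤ q) :
    2 * (Real.sqrt q⁻¹ * (q / (q + 1))) ≤ q ^ (-(1 / 16) : ℝ) := by
  have hq0 : 0 < q := by linarith
  have hb : q ≤ ((q + 1) ^ 2 / (4 * q)) ^ 8 := by
    have h1 : (q + 1) ^ 2 / (4 * q) = 1 + (q - 1) ^ 2 / (4 * q) := by field_simp; ring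
    rw [h1]
    have h2 : (0 : ℝ) ≤ (q - 1) ^ 2 / (4 * q) := by positivity
    refine le_trans ?_ (one_add_mul_le_pow (by linarith) 8)
    -- After division by `q - 1` this says `q ≤ 2(q - 1)`, which is where `q ≥ 2` enters. It fixes
    -- the Bernoulli exponent `8`, and with the square root the constant `1/16`.
    have h3 : (q - 1) / 8 ≤ (q - 1) ^ 2 / (4 * q) := by
      rw [div_le_div_iff₀ (by norm_num) (by positivity)]
      nlinarith [mul_nonneg (sub_nonneg.2 hq) (by linarith : (0 : ℝ) ≤ q - 1)]
    push_cast
    linarith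
  have hl : (2 * (Real.sqrt q⁻¹ * (q / (q + 1)))) ^ 16 = (((q + 1) ^ 2 / (4 * q)) ^ 8)⁻¹ := by
    have hs : (2 * (Real.sqrt q⁻¹ * (q / (q + 1)))) ^ 2 = ((q + 1) ^ 2 / (4 * q))⁻¹ := by
      rw [mul_pow, mul_pow, Real.sq_sqrt (by positivity)]
      field_simp
      ring
    rw [show 16 = 2 * 8 from rfl, pow_mul, hs, inv_pow]
  have hr : (q ^ (-(1 / 16) : ℝ)) ^ 16 = q⁻¹ := by
    rw [← Real.rpow_natCast, ← Real.rpow_mul hq0.le]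
    norm_num
    exact Real.rpow_neg_one q
  refine le_of_pow_le_pow_left₀ (n := 16) (by norm_num) (by positivity) ?_
  rw [hl, hr]
  exact inv_anti₀ hq0 hb

end SecondMoment

/-! ### The circuit as a function of the gates and the parameters -/

section Circuit

variable {n q : ℕ}

theorem exp_mem_unitary {ι : Type} [Fintype ι] [DecidableEq ι] {A : Matrix ι ι ℂ}
    (hA : A.IsHermitian) (θ : ℝ) :
    NormedSpace.exp ((-(Complex.I * (θ : ℂ))) • A) ∈ Matrix.unitaryGroup ι ℂ := by
  rw [Matrix.mem_unitaryGroup_iff, Matrix.star_eq_conjTranspose, ← Matrix.exp_conjTranspose]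
  have h : ((-(Complex.I * (θ : ℂ))) • A)ᴴ = -((-(Complex.I * (θ : ℂ))) • A) := by
    rw [Matrix.conjTranspose_smul, hA.eq, ← neg_smul]
    simp
  rw [h]
  generalize (-(Complex.I * (θ : ℂ))) • A = X
  rw [← Matrix.exp_add_of_commute X (-X) ((Commute.refl X).neg_right), add_neg_cancel,
    NormedSpace.exp_zero]

theorem continuous_exp_smul {ι : Type} [Fintype ι] [DecidableEq ι] (A : Matrix ι ι ℂ) :
    Continuous fun θ : ℝ => NormedSpace.exp ((-(Complex.I * (θ : ℂ))) • A) := by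
  let : NormedRing (Matrix ι ι ℂ) := Matrix.linftyOpNormedRing
  let : NormedAlgebra ℂ (Matrix ι ι ℂ) := Matrix.linftyOpNormedAlgebra
  let : NormedAlgebra ℚ (Matrix ι ι ℂ) := NormedAlgebra.restrictScalars ℚ ℂ (Matrix ι ι ℂ)
  exact NormedSpace.exp_continuous.comp (by fun_prop)

theorem ParamGate.eval_mem_unitary (G : ParamGate q) (θ : ℝ) :
    G.eval θ ∈ Matrix.unitaryGroup (Fin q × Fin q) ℂ :=
  mul_mem (mul_mem G.Wl.2 (exp_mem_unitary G.isHermitian θ)) G.Wr.2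

theorem ParamGate.continuous_eval (G : ParamGate q) : Continuous G.eval :=
  (continuous_const.mul (continuous_exp_smul G.A)).mul continuous_const

namespace Ansatz

variable (C : Ansatz n q)

theorem block_mem_unitary (V : C.Realization) (θ : C.Param → ℝ) (t : Fin C.m) :
    C.block V θ t ∈ Matrix.unitaryGroup (Fin q × Fin q) ℂ :=
  mul_mem (mul_mem (timeProd_mem_unitary fun _ => ParamGate.eval_mem_unitary _ _) (V t).2)
    (timeProd_mem_unitary fun _ => ParamGate.eval_mem_unitary _ _)

theorem circuit_mem_unitary (V : C.Realization) (θ : C.Param → ℝ) :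
    C.circuit V θ ∈ Matrix.unitaryGroup (Fin n → Fin q) ℂ :=
  timeProd_mem_unitary fun t => onSites_mem_unitary (C.site_ne t) (C.block_mem_unitary V θ t)

theorem continuous_circuit :
    Continuous fun p : C.Realization × (C.Param → ℝ) => C.circuit p.1 p.2 := by
  refine continuous_timeProd fun t => (continuous_onSites _ _).comp ?_
  refine (Continuous.mul ?_ ?_).mul ?_
  · exact continuous_timeProd fun b => (ParamGate.continuous_eval _).comp
      ((continuous_apply _).comp continuous_snd)
  · exact continuous_subtype_val.comp ((continuous_apply t).comp continuous_fst)
  · exact continuous_timeProd fun b => (ParamGate.continuous_eval _).comp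
      ((continuous_apply _).comp continuous_snd)

instance (t : Fin C.m) : IsProbabilityMeasure (C.law t) := (C.isTwoDesign t).isProbabilityMeasure

instance : IsProbabilityMeasure C.gateLaw := by unfold gateLaw; infer_instance

instance : IsProbabilityMeasure
    (ProbabilityTheory.cond volume (Set.Icc 0 (2 * Real.pi)) : Measure ℝ) := by
  refine ProbabilityTheory.cond_isProbabilityMeasure_of_finite ?_ ?_
  · simp [Real.volume_Icc, Real.pi_pos]
  · simp [Real.volume_Icc, ENNReal.mul_eq_top]

instance : IsProbabilityMeasure C.paramLaw := by unfold paramLaw; infer_instance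

theorem expect_lift4_circuit (θ : C.Param → ℝ) :
    (∀ a b, Integrable (fun V => lift4 (C.circuit V θ) a b) C.gateLaw) ∧
    expect C.gateLaw (fun V => lift4 (C.circuit V θ)) =
      timeProd fun t => expect (C.law t) fun V => lift4 (onSites (C.site₁ t) (C.site₂ t)
        (timeProd (fun b => (C.post t b).eval (θ ⟨t, Sum.inr b⟩)) * V.1 *
          timeProd (fun a => (C.pre t a).eval (θ ⟨t, Sum.inl a⟩)))) := by
  have h := expect_timeProd C.law (fun t V => lift4 (onSites (C.site₁ t) (C.site₂ t)
        (timeProd (fun b => (C.post t b).eval (θ ⟨t, Sum.inr b⟩)) * V.1 *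
          timeProd (fun a => (C.pre t a).eval (θ ⟨t, Sum.inl a⟩)))))
    (fun t a b => integrable_of_continuous
      ((continuous_lift4.comp ((continuous_onSites _ _).comp
        ((continuous_const.mul continuous_subtype_val).mul continuous_const))).matrix_elem a b))
  have hl : ∀ V : C.Realization, lift4 (C.circuit V θ) = timeProd fun t =>
      lift4 (onSites (C.site₁ t) (C.site₂ t) (C.block V θ t)) := fun V =>
    timeProd_map lift4 lift4_one lift4_mul _
  simp only [hl]
  exact h

/-- A bounded continuous quantity is integrable in the gates and the parameters. -/
theorem integrable_of_continuous_of_bound {F : C.Realization × (C.Param → ℝ) → ℝ}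
    (hF : Continuous F) {B : ℝ} (hB : ∀ p, ‖F p‖ ≤ B) :
    Integrable F (C.gateLaw.prod C.paramLaw) :=
  Integrable.of_bound hF.aestronglyMeasurable B (Filter.Eventually.of_forall hB)

theorem average_eq_integral_prod {F : C.Realization → (C.Param → ℝ) → ℝ}
    (hF : Integrable (Function.uncurry F) (C.gateLaw.prod C.paramLaw)) :
    C.average F = ∫ p, F p.1 p.2 ∂(C.gateLaw.prod C.paramLaw) :=
  (integral_prod _ hF).symm

/-! ### Second moments of expectation values -/

variable [NeZero q]

theorem continuous_expval (O : Op n q) :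
    Continuous fun p : C.Realization × (C.Param → ℝ) => C.expval O p.1 p.2 := by
  have h := C.continuous_circuit
  exact ((h.matrix_conjTranspose.mul continuous_const).mul h).matrix_elem _ _

theorem norm_expval_le (O : Op n q) (V : C.Realization) (θ : C.Param → ℝ) :
    ‖C.expval O V θ‖ ≤ ∑ t, ∑ s, ‖O s t‖ := by
  have hU : ∀ s, ‖C.circuit V θ s (fun _ => 0)‖ ≤ 1 := fun s =>
    entry_norm_bound_of_unitary (C.circuit_mem_unitary V θ) s _
  rw [expval, Matrix.mul_apply]
  refine (norm_sum_le _ _).trans (Finset.sum_le_sum fun t _ => ?_)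
  rw [norm_mul]
  refine (mul_le_of_le_one_right (norm_nonneg _) (hU t)).trans ?_
  rw [Matrix.mul_apply]
  refine (norm_sum_le _ _).trans (Finset.sum_le_sum fun s _ => ?_)
  rw [norm_mul, Matrix.conjTranspose_apply, norm_star]
  exact mul_le_of_le_one_left (norm_nonneg _) (hU s)

/-- For fixed parameters, the second moment of the expectation value of a global observable. -/
theorem integral_norm_expval_sq_le (hq : 2 ≤ q) {M : Fin (q ^ 2) → Matrix (Fin q) (Fin q) ℂ}
    (hM : IsOperatorBasis M) (O : Op n q)
    (hO : ∀ x, coeff M O x ≠ 0 → (n : ℝ) / 2 ≤ (weight x : ℝ)) (θ : C.Param → ℝ) :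
    ∫ V, ‖C.expval O V θ‖ ^ 2 ∂C.gateLaw ≤
      (q : ℝ) ^ (-(1 / 16 * (n : ℝ))) * ∑ x, ‖coeff M O x‖ ^ 2 := by
  obtain ⟨hint, hexp⟩ := C.expect_lift4_circuit θ
  have hzero : (Pi.single ((fun _ => 0), (fun _ => 0), (fun _ => 0), fun _ => 0) 1 :
      Tensor4 (Fin n → Fin q)) = prodTensor fun _ => siteZero := by
    funext s
    simp only [prodTensor, siteZero, Pi.single_apply, quadAt]
    by_cases hs : s = ((fun _ => 0), (fun _ => 0), (fun _ => 0), fun _ => 0)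
    · subst hs; simp
    · rw [if_neg hs]
      by_contra hne
      refine hs ?_
      have hk : ∀ k, (s.1 k, s.2.1 k, s.2.2.1 k, s.2.2.2 k) = (0, 0, 0, 0) := by
        intro k
        by_contra h
        exact hne (Finset.prod_eq_zero (Finset.mem_univ k) (if_neg h)).symm
      simp only [Prod.mk.injEq] at hk
      exact Prod.ext (funext fun k => (hk k).1) (Prod.ext (funext fun k => (hk k).2.1)
        (Prod.ext (funext fun k => (hk k).2.2.1) (funext fun k => (hk k).2.2.2)))
  have hmom : ((∫ V, ‖C.expval O V θ‖ ^ 2 ∂C.gateLaw : ℝ) : ℂ) =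
      opTensor O O ⬝ᵥ (expect C.gateLaw (fun V => lift4 (C.circuit V θ)) *ᵥ
        prodTensor fun _ => siteZero) := by
    rw [← integral_complex_ofReal]
    have h : ∀ V, ((‖C.expval O V θ‖ ^ 2 : ℝ) : ℂ) = ∑ a, opTensor O O a *
        (lift4 (C.circuit V θ) *ᵥ prodTensor fun _ => siteZero) a := fun V => by
      rw [expval, norm_sq_eq_opTensor_dotProduct, hzero]
      rfl
    simp only [h]
    have hi : ∀ a, Integrable (fun V => (lift4 (C.circuit V θ) *ᵥ
        prodTensor fun _ => siteZero) a) C.gateLaw := fun a =>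
      integrable_finsetSum _ fun b _ => (hint a b).mul_const _
    rw [integral_finsetSum _ fun a _ => (hi a).const_mul _]
    refine Finset.sum_congr rfl fun a _ => ?_
    rw [integral_const_mul, integral_mulVec hint]
  have hre := congrArg Complex.re hmom
  rw [Complex.ofReal_re, hexp] at hre
  rw [hre]
  have hq1 : (1 : ℝ) ≤ q := by exact_mod_cast (by omega : 1 ≤ q)
  have hsum : 0 ≤ ∑ x, ‖coeff M O x‖ ^ 2 := Finset.sum_nonneg fun x _ => sq_nonneg _
  refine (re_dotProduct_timeProd_le (i := C.site₁) (j := C.site₂) (by omega) (opTensor O O)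
    (by positivity) (re_opTensor_dotProduct_le hM O hO)
    (fun t => isPairTwirl_expect hq (C.site_ne t) (C.isTwoDesign t)
      (timeProd_mem_unitary fun _ => ParamGate.eval_mem_unitary _ _)
      (timeProd_mem_unitary fun _ => ParamGate.eval_mem_unitary _ _))
    (m := fun _ => 1) (fun _ => isSiteState_siteZero) fun k => Or.inl (C.covered k)).trans ?_
  have hpow : (Real.sqrt (q : ℝ)⁻¹ * ((q : ℝ) / (q + 1))) ^ n * 2 ^ n ≤
      (q : ℝ) ^ (-(1 / 16 * (n : ℝ))) := by
    rw [← mul_pow, mul_comm _ (2 : ℝ), ← neg_mul, Real.rpow_mul (by linarith),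
      Real.rpow_natCast]
    exact pow_le_pow_left₀ (by positivity) (two_mul_sqrt_inv_mul_le (by exact_mod_cast hq)) n
  -- The potential of `|0ⁿ⟩`, each site having swap pairing `1`.
  have htwo : ∏ _k : Fin n, ((1 : ℝ) + 1) = 2 ^ n := by
    rw [Finset.prod_const, Finset.card_univ, Fintype.card_fin]
    norm_num
  rw [htwo]
  calc _ = ((Real.sqrt (q : ℝ)⁻¹ * ((q : ℝ) / (q + 1))) ^ n * 2 ^ n) *
        ∑ x, ‖coeff M O x‖ ^ 2 := by ring
    _ ≤ _ := mul_le_mul_of_nonneg_right hpow hsum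

theorem average_norm_expval_sq_le (hq : 2 ≤ q) {M : Fin (q ^ 2) → Matrix (Fin q) (Fin q) ℂ}
    (hM : IsOperatorBasis M) (O : Op n q)
    (hO : ∀ x, coeff M O x ≠ 0 → (n : ℝ) / 2 ≤ (weight x : ℝ)) :
    C.average (fun V θ => ‖C.expval O V θ‖ ^ 2) ≤
      (q : ℝ) ^ (-(1 / 16 * (n : ℝ))) * ∑ x, ‖coeff M O x‖ ^ 2 := by
  have hint : Integrable (Function.uncurry fun V θ => ‖C.expval O V θ‖ ^ 2)
      (C.gateLaw.prod C.paramLaw) :=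
    C.integrable_of_continuous_of_bound ((C.continuous_expval O).norm.pow 2)
      (B := (∑ t, ∑ s, ‖O s t‖) ^ 2) fun p => by
        rw [Function.uncurry, Real.norm_of_nonneg (sq_nonneg _)]
        exact pow_le_pow_left₀ (norm_nonneg _) (C.norm_expval_le O _ _) 2
  rw [average, integral_integral_swap hint]
  calc _ ≤ ∫ _θ, (q : ℝ) ^ (-(1 / 16 * (n : ℝ))) * ∑ x, ‖coeff M O x‖ ^ 2 ∂C.paramLaw :=
        integral_mono hint.integral_prod_right (integrable_const _)
          (C.integral_norm_expval_sq_le hq hM O hO)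
    _ = _ := by simp

theorem continuous_objective (H : Op n q) :
    Continuous fun p : C.Realization × (C.Param → ℝ) => C.objective H p.1 p.2 :=
  Complex.continuous_re.comp (C.continuous_expval H)

theorem abs_objective_le (H : Op n q) (V : C.Realization) (θ : C.Param → ℝ) :
    |C.objective H V θ| ≤ ∑ t, ∑ s, ‖H s t‖ :=
  (Complex.abs_re_le_norm _).trans (C.norm_expval_le H V θ)

theorem integrable_objective_sq (H : Op n q) :
    Integrable (Function.uncurry fun V θ => C.objective H V θ ^ 2)
      (C.gateLaw.prod C.paramLaw) :=
  C.integrable_of_continuous_of_bound ((C.continuous_objective H).pow 2)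
    (B := (∑ t, ∑ s, ‖H s t‖) ^ 2) fun p => by
      rw [Function.uncurry, norm_pow, Real.norm_eq_abs]
      exact pow_le_pow_left₀ (abs_nonneg _) (C.abs_objective_le H _ _) 2

theorem integrable_abs_objective (H : Op n q) :
    Integrable (Function.uncurry fun V θ => |C.objective H V θ|)
      (C.gateLaw.prod C.paramLaw) :=
  C.integrable_of_continuous_of_bound (C.continuous_objective H).abs
    (B := ∑ t, ∑ s, ‖H s t‖) fun p => by
      rw [Function.uncurry, Real.norm_eq_abs, abs_abs]
      exact C.abs_objective_le H _ _

theorem average_objective_sq_le (hq : 2 ≤ q) {M : Fin (q ^ 2) → Matrix (Fin q) (Fin q) ℂ}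
    (hM : IsOperatorBasis M) (H : Op n q)
    (hH : ∀ x, coeff M H x ≠ 0 → (n : ℝ) / 2 ≤ (weight x : ℝ)) :
    C.average (fun V θ => C.objective H V θ ^ 2) ≤
      (q : ℝ) ^ (-(1 / 16 * (n : ℝ))) * ∑ x, ‖coeff M H x‖ ^ 2 := by
  refine le_trans ?_ (C.average_norm_expval_sq_le hq hM H hH)
  have hint : Integrable (Function.uncurry fun V θ => ‖C.expval H V θ‖ ^ 2)
      (C.gateLaw.prod C.paramLaw) :=
    C.integrable_of_continuous_of_bound ((C.continuous_expval H).norm.pow 2)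
      (B := (∑ t, ∑ s, ‖H s t‖) ^ 2) fun p => by
        rw [Function.uncurry, Real.norm_of_nonneg (sq_nonneg _)]
        exact pow_le_pow_left₀ (norm_nonneg _) (C.norm_expval_le H _ _) 2
  rw [C.average_eq_integral_prod hint, C.average_eq_integral_prod (C.integrable_objective_sq H)]
  refine integral_mono (C.integrable_objective_sq H) hint fun p => ?_
  change (C.objective H p.1 p.2) ^ 2 ≤ ‖C.expval H p.1 p.2‖ ^ 2
  rw [← sq_abs]
  exact pow_le_pow_left₀ (abs_nonneg _) (Complex.abs_re_le_norm _) 2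

theorem average_abs_objective_le (H : Op n q) :
    C.average (fun V θ => |C.objective H V θ|) ≤
      Real.sqrt (C.average fun V θ => C.objective H V θ ^ 2) := by
  rw [C.average_eq_integral_prod (C.integrable_abs_objective H),
    C.average_eq_integral_prod (C.integrable_objective_sq H)]
  refine Real.le_sqrt_of_sq_le ?_
  set a := ∫ p, |C.objective H p.1 p.2| ∂(C.gateLaw.prod C.paramLaw) with ha
  -- Nonnegativity of the variance of `|f|` gives `(E|f|)² ≤ E f²`.
  have h1 : 0 ≤ ∫ p, (|C.objective H p.1 p.2| - a) ^ 2 ∂(C.gateLaw.prod C.paramLaw) :=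
    integral_nonneg fun p => sq_nonneg _
  have h2 : ∀ p : C.Realization × (C.Param → ℝ), (|C.objective H p.1 p.2| - a) ^ 2 =
      C.objective H p.1 p.2 ^ 2 - 2 * a * |C.objective H p.1 p.2| + a ^ 2 := fun p => by
    rw [sub_sq, sq_abs]; ring
  have hi1 : Integrable (fun p : C.Realization × (C.Param → ℝ) => C.objective H p.1 p.2 ^ 2)
    (C.gateLaw.prod C.paramLaw) := C.integrable_objective_sq H
  have hi2 : Integrable (fun p : C.Realization × (C.Param → ℝ) =>
    2 * a * |C.objective H p.1 p.2|) (C.gateLaw.prod C.paramLaw) :=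
    Integrable.const_mul (C.integrable_abs_objective H) _
  simp only [h2] at h1
  have h3 := integral_add (hi1.sub hi2) (integrable_const (a ^ 2))
  simp only [Pi.sub_apply] at h3
  rw [h3, integral_sub hi1 hi2, integral_const_mul, ← ha, integral_const] at h1
  simp only [probReal_univ, one_smul] at h1
  nlinarith

end Ansatz

end Circuit

/-! ### Trigonometric dependence on a single parameter -/

section OneParameter

open scoped Matrix.Norms.L2Operator

/-- A star homomorphism between C*-algebras is contractive, so placing a generator on its sites does
not increase its operator norm. -/
theorem norm_onSites_le {n q : ℕ} {i j : Fin n} (hij : i ≠ j)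
    (B : Matrix (Fin q × Fin q) (Fin q × Fin q) ℂ) : ‖onSites i j B‖ ≤ ‖B‖ :=
  NonUnitalStarAlgHom.norm_apply_le (onSitesHom hij) B

theorem onSites_exp {n q : ℕ} {i j : Fin n} (hij : i ≠ j)
    (B : Matrix (Fin q × Fin q) (Fin q × Fin q) ℂ) :
    onSites i j (NormedSpace.exp B) = NormedSpace.exp (onSites i j B) := by
  let : NormedAlgebra ℚ (Matrix (Fin q × Fin q) (Fin q × Fin q) ℂ) :=
    NormedAlgebra.restrictScalars ℚ ℂ _
  let : NormedAlgebra ℚ (Op n q) := NormedAlgebra.restrictScalars ℚ ℂ _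
  exact NormedSpace.map_exp (onSitesHom hij) (continuous_onSites i j) B

variable {ι : Type} [Fintype ι] [DecidableEq ι]

theorem norm_entry_le (B : Matrix ι ι ℂ) (a b : ι) : ‖B a b‖ ≤ ‖B‖ := by
  have h := Matrix.l2_opNorm_mulVec B (EuclideanSpace.single b (1 : ℂ))
  rw [PiLp.norm_single, norm_one, mul_one] at h
  refine le_trans ?_ h
  refine le_trans (le_of_eq ?_) (PiLp.norm_apply_le _ a)
  simp

theorem norm_conj_entry_le {U : Matrix ι ι ℂ} (hU : U ∈ Matrix.unitaryGroup ι ℂ)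
    (K : Matrix ι ι ℂ) (a b : ι) : ‖(Uᴴ * K * U) a b‖ ≤ ‖K‖ := by
  refine (norm_entry_le _ a b).trans (le_of_eq ?_)
  rw [CStarRing.norm_mul_mem_unitary _ hU]
  exact CStarRing.norm_mem_unitary_mul _ (Unitary.star_mem hU)

/-- The Heisenberg evolution of `K` generated by `X`, a skew-adjoint operator. -/
def heisenberg (X K : Matrix ι ι ℂ) (s : ℝ) : Matrix ι ι ℂ :=
  NormedSpace.exp (s • -X) * K * NormedSpace.exp (s • X)

/-- Since `X` commutes with its exponential, the derivative is again an evolved operator, with `K`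
replaced by a commutator. Iterating gives all higher derivatives, each at the cost of a factor
`2‖X‖` in norm. -/
theorem hasDerivAt_heisenberg (X K : Matrix ι ι ℂ) (s : ℝ) :
    HasDerivAt (heisenberg X K) (heisenberg X (K * X - X * K) s) s := by
  have h1 := hasDerivAt_exp_smul_const (𝕂 := ℝ) (-X) s
  have h2 := hasDerivAt_exp_smul_const' (𝕂 := ℝ) X s
  have h := (h1.mul_const K).mul h2
  refine h.congr_deriv ?_
  simp only [heisenberg]
  noncomm_ring

theorem norm_commutator_le (K X : Matrix ι ι ℂ) : ‖K * X - X * K‖ ≤ 2 * ‖X‖ * ‖K‖ := by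
  refine (norm_sub_le _ _).trans ?_
  have h1 := norm_mul_le K X
  have h2 := norm_mul_le X K
  linarith [mul_comm ‖K‖ ‖X‖]

theorem hasDerivAt_re_heisenberg (X K Q : Matrix ι ι ℂ) (z : ι) (s : ℝ) :
    HasDerivAt (fun s => ((Qᴴ * heisenberg X K s * Q) z z).re)
      ((Qᴴ * heisenberg X (K * X - X * K) s * Q) z z).re s := by
  have h := ((hasDerivAt_heisenberg X K s).const_mul Qᴴ).mul_const Q
  let φ : Matrix ι ι ℂ →ₗ[ℝ] ℝ :=
    Complex.reLm ∘ₗ (Matrix.entryLinearMap ℝ ℂ z z)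
  exact (φ.toContinuousLinearMap.hasFDerivAt.comp_hasDerivAt s h :)

theorem abs_re_heisenberg_le {A Q : Matrix ι ι ℂ} (hA : A.IsHermitian)
    (hQ : Q ∈ Matrix.unitaryGroup ι ℂ) (K : Matrix ι ι ℂ) (z : ι) (s : ℝ) :
    |((Qᴴ * heisenberg (-(Complex.I • A)) K s * Q) z z).re| ≤ ‖K‖ := by
  refine (Complex.abs_re_le_norm _).trans ?_
  have hU : NormedSpace.exp (s • (-(Complex.I • A))) * Q ∈ Matrix.unitaryGroup ι ℂ := by
    refine mul_mem ?_ hQ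
    have := exp_mem_unitary hA s
    convert! this using 2
    ext a b
    simp
    ring
  have hstar : (NormedSpace.exp (s • (-(Complex.I • A))))ᴴ =
      NormedSpace.exp (s • -(-(Complex.I • A))) := by
    rw [← Matrix.exp_conjTranspose]
    congr 1
    ext a b
    have := congrFun (congrFun hA.eq a) b
    rw [Matrix.conjTranspose_apply] at this
    simp [Matrix.conjTranspose_apply, ← this]
  have h := norm_conj_entry_le hU K z z
  rw [Matrix.conjTranspose_mul, hstar] at h
  rw [heisenberg]
  simpa only [mul_assoc] using h

end OneParameter

/-! ### A Poincaré-type inequality for periodic functions -/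

section Periodic

/-- Integration by parts turns `∫ h' h'` into `-∫ h'' h`; the boundary terms cancel by periodicity
of `h` and `h'`. -/
theorem integral_deriv_sq_le {T C : ℝ} (hT : 0 ≤ T) {h h' h'' : ℝ → ℝ}
    (h1 : ∀ s, HasDerivAt h (h' s) s) (h2 : ∀ s, HasDerivAt h' (h'' s) s) (hc : Continuous h'')
    (hb : ∀ s, |h'' s| ≤ C) (hp : h T = h 0) (hp' : h' T = h' 0) :
    ∫ s in 0..T, h' s ^ 2 ≤ C * ∫ s in 0..T, |h s| := by
  have hch : Continuous h := continuous_iff_continuousAt.2 fun s => (h1 s).continuousAt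
  have hch' : Continuous h' := continuous_iff_continuousAt.2 fun s => (h2 s).continuousAt
  have hparts := intervalIntegral.integral_mul_deriv_eq_deriv_mul_of_hasDerivAt
    (a := 0) (b := T) hch'.continuousOn hch.continuousOn (fun s _ => h2 s) (fun s _ => h1 s)
    (hc.intervalIntegrable _ _) (hch'.intervalIntegrable _ _)
  rw [hp, hp', sub_self, zero_sub, ← intervalIntegral.integral_neg] at hparts
  simp only [sq]
  rw [hparts, ← intervalIntegral.integral_const_mul]
  refine intervalIntegral.integral_mono_on hT ((hc.mul hch).neg.intervalIntegrable _ _)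
    ((continuous_const.mul hch.abs).intervalIntegrable _ _) fun s _ => ?_
  calc -(h'' s * h s) ≤ |h'' s| * |h s| := by rw [← abs_mul]; exact neg_le_abs _
    _ ≤ C * |h s| := mul_le_mul_of_nonneg_right (hb s) (abs_nonneg _)

theorem integral_cond_Icc {T : ℝ} (hT : 0 ≤ T) (f : ℝ → ℝ) :
    ∫ s, f s ∂(ProbabilityTheory.cond volume (Set.Icc 0 T)) = T⁻¹ * ∫ s in 0..T, f s := by
  rw [ProbabilityTheory.cond, integral_smul_measure, intervalIntegral.integral_of_le hT,
    integral_Icc_eq_integral_Ioc]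
  simp [Real.volume_Icc, hT]

/-- Resampling one coordinate of a product probability measure preserves it. -/
theorem measurePreserving_update {ι α : Type*} [Fintype ι] [DecidableEq ι] [MeasurableSpace α]
    (μ : ι → Measure α) [∀ i, IsProbabilityMeasure (μ i)] (l : ι) :
    MeasurePreserving (fun p : (ι → α) × α => Function.update p.1 l p.2)
      ((Measure.pi μ).prod (μ l)) (Measure.pi μ) := by
  have hmeas : Measurable fun p : (ι → α) × α => Function.update p.1 l p.2 := by
    exact measurable_update'
  refine ⟨hmeas, (Measure.pi_eq fun s hs => ?_).symm⟩
  rw [Measure.map_apply hmeas (MeasurableSet.univ_pi hs)]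
  -- The old value at `l` is overwritten, so it is unconstrained and contributes total mass `1`.
  have hset : (fun p : (ι → α) × α => Function.update p.1 l p.2) ⁻¹' Set.univ.pi s =
      (Set.univ.pi (Function.update s l Set.univ)) ×ˢ s l := by
    ext p
    simp only [Set.mem_preimage, Set.mem_pi, Set.mem_univ, true_implies, Set.mem_prod]
    constructor
    · intro h
      refine ⟨fun i => ?_, by simpa using h l⟩
      by_cases hi : i = l
      · subst hi; simp
      · simpa [hi] using h i
    · rintro ⟨h, hl⟩ i
      by_cases hi : i = l
      · subst hi; simpa using hl
      · simpa [hi] using h i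
  rw [hset, Measure.prod_prod, Measure.pi_pi, ← Finset.mul_prod_erase _ _ (Finset.mem_univ l),
    ← Finset.mul_prod_erase Finset.univ (fun i => μ i (s i)) (Finset.mem_univ l)]
  rw [Function.update_self, measure_univ, one_mul, mul_comm]
  congr 1
  refine Finset.prod_congr rfl fun i hi => ?_
  rw [Function.update_of_ne (Finset.ne_of_mem_erase hi)]

theorem integral_resample {ι α : Type*} [Fintype ι] [DecidableEq ι] [MeasurableSpace α]
    (μ : ι → Measure α) [∀ i, IsProbabilityMeasure (μ i)] (l : ι) {f : (ι → α) → ℝ}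
    (hf : Integrable f (Measure.pi μ)) :
    Integrable (fun p : (ι → α) × α => f (Function.update p.1 l p.2))
      ((Measure.pi μ).prod (μ l)) ∧
    ∫ θ, f θ ∂(Measure.pi μ) = ∫ θ, ∫ s, f (Function.update θ l s) ∂(μ l) ∂(Measure.pi μ) := by
  have hmp := measurePreserving_update μ l
  have hi : Integrable (fun p : (ι → α) × α => f (Function.update p.1 l p.2))
      ((Measure.pi μ).prod (μ l)) := hmp.integrable_comp_of_integrable hf
  refine ⟨hi, ?_⟩
  rw [← integral_prod _ hi, ← integral_map (φ := fun p : (ι → α) × α => Function.update p.1 l p.2)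
    (f := f) hmp.measurable.aemeasurable (by rw [hmp.map_eq]; exact hf.aestronglyMeasurable),
    hmp.map_eq]

end Periodic

/-! ### Derivatives of the objective and the gradient bound -/

namespace Ansatz

variable {n q : ℕ} (C : Ansatz n q)

/-- The circuit as a function of a single parameter. -/
theorem exists_circuit_update (V : C.Realization) (θ : C.Param → ℝ) (l : C.Param) :
    ∃ P ∈ Matrix.unitaryGroup (Fin n → Fin q) ℂ, ∃ Q ∈ Matrix.unitaryGroup (Fin n → Fin q) ℂ,
      ∀ s : ℝ, C.circuit V (Function.update θ l s) =
        P * onSites (C.site₁ l.1) (C.site₂ l.1)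
          (NormedSpace.exp ((-(Complex.I * (s : ℂ))) • (C.gate l).A)) * Q := by
  obtain ⟨t, x⟩ := l
  have hblock : ∃ P ∈ Matrix.unitaryGroup (Fin q × Fin q) ℂ,
      ∃ Q ∈ Matrix.unitaryGroup (Fin q × Fin q) ℂ,
      ∀ s : ℝ, C.block V (Function.update θ ⟨t, x⟩ s) t =
        P * NormedSpace.exp ((-(Complex.I * (s : ℂ))) • (C.gate ⟨t, x⟩).A) * Q := by
    rcases x with a | b
    · obtain ⟨P, hP, Q, hQ, h⟩ := exists_timeProd_update
        (F := fun a => (C.pre t a).eval (θ ⟨t, Sum.inl a⟩))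
        (fun _ => ParamGate.eval_mem_unitary _ _) a
      refine ⟨timeProd (fun b => (C.post t b).eval (θ ⟨t, Sum.inr b⟩)) * (V t).1 *
          (P * (C.pre t a).Wl.1), mul_mem (mul_mem (timeProd_mem_unitary fun _ =>
            ParamGate.eval_mem_unitary _ _) (V t).2) (mul_mem hP (C.pre t a).Wl.2),
          (C.pre t a).Wr.1 * Q, mul_mem (C.pre t a).Wr.2 hQ, fun s => ?_⟩
      have h1 : (fun a' => (C.pre t a').eval
          (Function.update θ ⟨t, Sum.inl a⟩ s ⟨t, Sum.inl a'⟩)) =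
          Function.update (fun a => (C.pre t a).eval (θ ⟨t, Sum.inl a⟩)) a
            ((C.pre t a).eval s) := by
        funext a'
        by_cases ha : a' = a
        · subst ha; simp
        · simp [ha]
      have h2 : (fun b => (C.post t b).eval
          (Function.update θ ⟨t, Sum.inl a⟩ s ⟨t, Sum.inr b⟩)) =
          fun b => (C.post t b).eval (θ ⟨t, Sum.inr b⟩) := by
        funext b
        simp
      rw [block, h1, h2, h, ParamGate.eval]
      simp only [mul_assoc, gate]
    · obtain ⟨P, hP, Q, hQ, h⟩ := exists_timeProd_update
        (F := fun b => (C.post t b).eval (θ ⟨t, Sum.inr b⟩))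
        (fun _ => ParamGate.eval_mem_unitary _ _) b
      refine ⟨P * (C.post t b).Wl.1, mul_mem hP (C.post t b).Wl.2,
          (C.post t b).Wr.1 * Q * (V t).1 *
            timeProd (fun a => (C.pre t a).eval (θ ⟨t, Sum.inl a⟩)),
          mul_mem (mul_mem (mul_mem (C.post t b).Wr.2 hQ) (V t).2)
            (timeProd_mem_unitary fun _ => ParamGate.eval_mem_unitary _ _), fun s => ?_⟩
      have h1 : (fun b' => (C.post t b').eval
          (Function.update θ ⟨t, Sum.inr b⟩ s ⟨t, Sum.inr b'⟩)) =
          Function.update (fun b => (C.post t b).eval (θ ⟨t, Sum.inr b⟩)) b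
            ((C.post t b).eval s) := by
        funext b'
        by_cases hb : b' = b
        · subst hb; simp
        · simp [hb]
      have h2 : (fun a => (C.pre t a).eval
          (Function.update θ ⟨t, Sum.inr b⟩ s ⟨t, Sum.inl a⟩)) =
          fun a => (C.pre t a).eval (θ ⟨t, Sum.inl a⟩) := by
        funext a
        simp
      rw [block, h1, h2, h, ParamGate.eval]
      simp only [mul_assoc, gate]
  obtain ⟨P₀, hP₀, Q₀, hQ₀, h₀⟩ := hblock
  obtain ⟨P, hP, Q, hQ, h⟩ := exists_timeProd_update
    (F := fun t => onSites (C.site₁ t) (C.site₂ t) (C.block V θ t))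
    (fun t => onSites_mem_unitary (C.site_ne t) (C.block_mem_unitary V θ t)) t
  refine ⟨P * onSites (C.site₁ t) (C.site₂ t) P₀,
    mul_mem hP (onSites_mem_unitary (C.site_ne t) hP₀),
    onSites (C.site₁ t) (C.site₂ t) Q₀ * Q,
    mul_mem (onSites_mem_unitary (C.site_ne t) hQ₀) hQ, fun s => ?_⟩
  have hF : (fun t' => onSites (C.site₁ t') (C.site₂ t')
      (C.block V (Function.update θ ⟨t, x⟩ s) t')) =
      Function.update (fun t => onSites (C.site₁ t) (C.site₂ t) (C.block V θ t)) t
        (onSites (C.site₁ t) (C.site₂ t) (C.block V (Function.update θ ⟨t, x⟩ s) t)) := by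
    funext t'
    by_cases ht : t' = t
    · subst ht; simp
    · rw [Function.update_of_ne ht]
      have hne : ∀ y, (⟨t', y⟩ : C.Param) ≠ ⟨t, x⟩ := fun y he => ht (congrArg Sigma.fst he)
      simp only [block, Function.update_of_ne (hne _)]
  rw [circuit, hF, h, h₀, onSites_mul (C.site_ne t), onSites_mul (C.site_ne t)]
  simp only [mul_assoc]

variable [NeZero q]

open scoped Matrix.Norms.L2Operator in
/-- The objective function is a twice differentiable periodic function of each parameter. -/
theorem exists_hasDerivAt_objective (H : Op n q) (V : C.Realization) (θ : C.Param → ℝ)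
    (l : C.Param) : ∃ h' h'' : ℝ → ℝ,
      (∀ s, HasDerivAt (fun s => C.objective H V (Function.update θ l s)) (h' s) s) ∧
      (∀ s, HasDerivAt h' (h'' s) s) ∧ Continuous h'' ∧
      (∀ s, |h' s| ≤ 2 * opNorm (C.gate l).A * opNorm H) ∧
      (∀ s, |h'' s| ≤ 4 * opNorm (C.gate l).A ^ 2 * opNorm H) ∧
      C.objective H V (Function.update θ l (2 * Real.pi)) =
        C.objective H V (Function.update θ l 0) ∧
      h' (2 * Real.pi) = h' 0 := by
  obtain ⟨P, hP, Q, hQ, hPQ⟩ := C.exists_circuit_update V θ l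
  set i := C.site₁ l.1
  set j := C.site₂ l.1
  have hij : i ≠ j := C.site_ne l.1
  set A := onSites i j (C.gate l).A with hAdef
  have hA : A.IsHermitian := by
    rw [Matrix.IsHermitian, hAdef, ← onSites_conjTranspose, (C.gate l).isHermitian.eq]
  set X : Op n q := -(Complex.I • A) with hX
  have hexp : ∀ s : ℝ, onSites i j (NormedSpace.exp ((-(Complex.I * (s : ℂ))) • (C.gate l).A)) =
      NormedSpace.exp (s • X) := by
    intro s
    rw [onSites_exp hij, onSites_smul, ← hAdef]
    congr 1
    ext a b
    simp [hX]
    ring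
  have hstar : ∀ s : ℝ, (NormedSpace.exp (s • X))ᴴ = NormedSpace.exp (s • -X) := by
    intro s
    rw [← Matrix.exp_conjTranspose]
    congr 1
    ext a b
    have := congrFun (congrFun hA.eq a) b
    rw [Matrix.conjTranspose_apply] at this
    simp [hX, Matrix.conjTranspose_apply, ← this]
  -- Periodicity of the single exponential suffices: it makes every evolved operator periodic, hence
  -- the objective and its derivative together.
  have hper : NormedSpace.exp ((2 * Real.pi) • X) = NormedSpace.exp ((0 : ℝ) • X) := by
    rw [← hexp, ← hexp]
    have := (C.gate l).periodic 0
    simp only [zero_add] at this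
    rw [this]
  have hperK : ∀ K, heisenberg X K (2 * Real.pi) = heisenberg X K 0 := by
    intro K
    rw [heisenberg, heisenberg, ← hstar, ← hstar, hper]
  set K := Pᴴ * H * P with hK
  have hobj : ∀ s, C.objective H V (Function.update θ l s) =
      ((Qᴴ * heisenberg X K s * Q) (fun _ => 0) (fun _ => 0)).re := by
    intro s
    rw [objective, expval, hPQ, hexp, heisenberg, ← hstar, hK]
    simp only [Matrix.conjTranspose_mul, mul_assoc]
  have hKn : ‖K‖ ≤ opNorm H := by
    rw [hK, CStarRing.norm_mul_mem_unitary _ hP]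
    exact (CStarRing.norm_mem_unitary_mul _ (Unitary.star_mem hP)).le
  have hXn : ‖X‖ ≤ opNorm (C.gate l).A := by
    rw [hX, norm_neg, norm_smul, Complex.norm_I, one_mul]
    exact norm_onSites_le hij _
  have hX0 : 0 ≤ opNorm (C.gate l).A := (norm_nonneg X).trans hXn
  have hK1 : ‖K * X - X * K‖ ≤ 2 * opNorm (C.gate l).A * opNorm H :=
    (norm_commutator_le K X).trans (by gcongr)
  set K1 := K * X - X * K with hK1def
  have hK2 : ‖K1 * X - X * K1‖ ≤ 4 * opNorm (C.gate l).A ^ 2 * opNorm H :=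
    calc _ ≤ 2 * ‖X‖ * ‖K1‖ := norm_commutator_le K1 X
      _ ≤ 2 * opNorm (C.gate l).A * (2 * opNorm (C.gate l).A * opNorm H) := by gcongr
      _ = _ := by ring
  refine ⟨fun s => ((Qᴴ * heisenberg X K1 s * Q) (fun _ => 0) (fun _ => 0)).re,
    fun s => ((Qᴴ * heisenberg X (K1 * X - X * K1) s * Q) (fun _ => 0) (fun _ => 0)).re,
    fun s => ?_, fun s => hasDerivAt_re_heisenberg X K1 Q _ s, ?_,
    fun s => (abs_re_heisenberg_le hA hQ K1 _ s).trans hK1,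
    fun s => (abs_re_heisenberg_le hA hQ _ _ s).trans hK2, ?_, ?_⟩
  · simp only [hobj]
    exact hasDerivAt_re_heisenberg X K Q _ s
  · exact continuous_iff_continuousAt.2 fun s =>
      (hasDerivAt_re_heisenberg X (K1 * X - X * K1) Q _ s).continuousAt
  · rw [hobj, hobj, hperK]
  · simp only [hperK]

theorem partialDeriv_update (H : Op n q) (V : C.Realization) (θ : C.Param → ℝ) (l : C.Param)
    (s : ℝ) : C.partialDeriv H V (Function.update θ l s) l =
      deriv (fun u => C.objective H V (Function.update θ l u)) s := by
  simp [partialDeriv]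

theorem abs_partialDeriv_le (H : Op n q) (V : C.Realization) (θ : C.Param → ℝ) (l : C.Param) :
    |C.partialDeriv H V θ l| ≤ 2 * opNorm (C.gate l).A * opNorm H := by
  obtain ⟨h', h'', h1, -, -, hb, -⟩ := C.exists_hasDerivAt_objective H V θ l
  rw [partialDeriv, (h1 _).deriv]
  exact hb _

theorem measurable_partialDeriv (H : Op n q) (V : C.Realization) (l : C.Param) :
    Measurable fun θ => C.partialDeriv H V θ l := by
  have hu : Continuous fun p : (C.Param → ℝ) × ℝ =>
      ((V, Function.update p.1 l p.2) : C.Realization × (C.Param → ℝ)) :=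
    continuous_const.prodMk (continuous_fst.update l continuous_snd)
  have hc : Continuous (Function.uncurry fun (θ : C.Param → ℝ) (s : ℝ) =>
      C.objective H V (Function.update θ l s)) := by
    have h := (C.continuous_objective H).comp hu
    simp only [Function.comp_def] at h
    rw [Function.uncurry_def]
    exact h
  have hm : Measurable fun θ : C.Param → ℝ => (θ, θ l) :=
    measurable_id.prodMk (measurable_pi_apply l)
  have h := (measurable_deriv_with_param hc).comp hm
  simp only [Function.comp_def] at h
  simp only [partialDeriv]
  exact h

theorem integrable_partialDeriv_sq (H : Op n q) (V : C.Realization) (l : C.Param) :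
    Integrable (fun θ => C.partialDeriv H V θ l ^ 2) C.paramLaw :=
  Integrable.of_bound ((C.measurable_partialDeriv H V l).pow_const 2).aestronglyMeasurable
    ((2 * opNorm (C.gate l).A * opNorm H) ^ 2) (Filter.Eventually.of_forall fun θ => by
      rw [norm_pow, Real.norm_eq_abs]
      exact pow_le_pow_left₀ (abs_nonneg _) (C.abs_partialDeriv_le H V θ l) 2)

theorem integrable_abs_objective_param (H : Op n q) (V : C.Realization) :
    Integrable (fun θ => |C.objective H V θ|) C.paramLaw :=
  Integrable.of_bound ((C.continuous_objective H).comp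
      (continuous_const.prodMk continuous_id)).abs.aestronglyMeasurable
    (∑ t, ∑ s, ‖H s t‖) (Filter.Eventually.of_forall fun θ => by
      rw [Real.norm_eq_abs, abs_abs]
      exact C.abs_objective_le H V θ)

/-- Resampling the `l`-th parameter makes the inner integral one-dimensional over a full period,
where `integral_deriv_sq_le` applies; the normalization `(2π)⁻¹` is common to both sides. -/
theorem integral_partialDeriv_sq_le (H : Op n q) (V : C.Realization) (l : C.Param) :
    ∫ θ, C.partialDeriv H V θ l ^ 2 ∂C.paramLaw ≤
      4 * opNorm (C.gate l).A ^ 2 * opNorm H * ∫ θ, |C.objective H V θ| ∂C.paramLaw := by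
  obtain ⟨hi1, he1⟩ := integral_resample _ l (C.integrable_partialDeriv_sq H V l)
  obtain ⟨hi2, he2⟩ := integral_resample _ l (C.integrable_abs_objective_param H V)
  rw [paramLaw, he1, he2, ← integral_const_mul]
  refine integral_mono hi1.integral_prod_left (hi2.integral_prod_left.const_mul _) fun θ => ?_
  have hpi : 0 ≤ 2 * Real.pi := by positivity
  obtain ⟨h', h'', h1, h2, hc, -, hb, hp, hp'⟩ := C.exists_hasDerivAt_objective H V θ l
  simp only [partialDeriv_update]
  rw [integral_cond_Icc hpi, integral_cond_Icc hpi, mul_left_comm]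
  refine mul_le_mul_of_nonneg_left ?_ (inv_nonneg.2 hpi)
  simp only [fun s => (h1 s).deriv]
  exact integral_deriv_sq_le hpi h1 h2 hc hb hp hp'

theorem average_gradNormSq_le (H : Op n q) :
    C.average (C.gradNormSq H) ≤ 4 * (∑ l, opNorm (C.gate l).A ^ 2) * opNorm H *
      C.average fun V θ => |C.objective H V θ| := by
  rw [average, average, ← integral_const_mul]
  -- This form of monotonicity asks for integrability of the upper bound only, so measurability of
  -- the gradient in `V` need not be established.
  refine integral_mono_of_nonneg (Filter.Eventually.of_forall fun V => integral_nonneg fun θ =>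
    Finset.sum_nonneg fun l _ => sq_nonneg _)
    ((C.integrable_abs_objective H).integral_prod_left.const_mul _)
    (Filter.Eventually.of_forall fun V => ?_)
  simp only [gradNormSq]
  rw [integral_finsetSum _ fun l _ => C.integrable_partialDeriv_sq H V l]
  refine (Finset.sum_le_sum fun l _ => C.integral_partialDeriv_sq_le H V l).trans (le_of_eq ?_)
  rw [← Finset.sum_mul, ← Finset.sum_mul, ← Finset.mul_sum]

end Ansatz

end BarrenPlateau

end

/-! ### The main theorem -/

theorem corollary2 :
    ∃ c : ℝ, 0 < c ∧
      ∀ (q n : ℕ) [NeZero q], 2 ≤ q →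
      ∀ (C : BarrenPlateau.Ansatz n q) (M : Fin (q ^ 2) → Matrix (Fin q) (Fin q) ℂ),
        BarrenPlateau.IsOperatorBasis M →
        (∀ x : Fin n → Fin (q ^ 2), (n : ℝ) / 2 ≤ (BarrenPlateau.weight x : ℝ) →
          C.g M x ≤ (q : ℝ) ^ (-(c * (n : ℝ)))) ∧
        (∀ H : BarrenPlateau.Op n q, H.IsHermitian →
          (∀ x : Fin n → Fin (q ^ 2), BarrenPlateau.coeff M H x ≠ 0 →
            (n : ℝ) / 2 ≤ (BarrenPlateau.weight x : ℝ)) →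
          C.average (fun V θ => C.objective H V θ ^ 2) ≤
              (q : ℝ) ^ (-(c * (n : ℝ))) * ∑ x, ‖BarrenPlateau.coeff M H x‖ ^ 2 ∧
          C.average (C.gradNormSq H) ≤
              4 * (∑ l, BarrenPlateau.opNorm (C.gate l).A ^ 2) * BarrenPlateau.opNorm H *
                ((q : ℝ) ^ (-(c * (n : ℝ) / 2)) *
                  Real.sqrt (∑ x, ‖BarrenPlateau.coeff M H x‖ ^ 2))) := by
  refine ⟨1 / 16, by norm_num, fun q n _ hq C M hM => ⟨fun x hx => ?_, fun H _ hH => ?_⟩⟩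
  -- The bound for `g_x` is the case `O = M_x`, whose only nonzero coefficient is `1` at `x`.
  · refine (C.average_norm_expval_sq_le hq hM (BarrenPlateau.tensorOp M x) fun y hy => ?_).trans
      (le_of_eq ?_)
    · rw [hM.coeff_tensorOp] at hy
      have hxy : x = y := by
        by_contra h
        exact hy (if_neg h)
      rwa [← hxy]
    · simp [hM.coeff_tensorOp, apply_ite]
  · have hsq := C.average_objective_sq_le hq hM H hH
    refine ⟨hsq, (C.average_gradNormSq_le H).trans ?_⟩
    have hq0 : (0 : ℝ) ≤ q := Nat.cast_nonneg q
    have hnn : 0 ≤ 4 * (∑ l, BarrenPlateau.opNorm (C.gate l).A ^ 2) * BarrenPlateau.opNorm H :=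
      mul_nonneg (mul_nonneg (by norm_num) (Finset.sum_nonneg fun l _ => sq_nonneg _))
        (norm_nonneg _)
    refine mul_le_mul_of_nonneg_left ?_ hnn
    refine (C.average_abs_objective_le H).trans ((Real.sqrt_le_sqrt hsq).trans (le_of_eq ?_))
    -- The square root in `E|f| ≤ (E f²)^{1/2}` halves the exponent of `q`.
    rw [Real.sqrt_mul (Real.rpow_nonneg hq0 _), Real.sqrt_eq_rpow, ← Real.rpow_mul hq0]
    congr 2
    ring
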